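/- Let $\mathbf C=\{0,1\}^{\mathbb N}$ be Cantor space with the product topology and the fair-coin (Lebesgue) measure $\mu$; write $A\upharpoonright n$ for the string of the first $n$ bits of $A\in\mathbf C$, and for a finite binary string $w$ let $[w]$ be the set of sequences in $\mathbf C$ that extend $w$. A Schnorr test is a sequence $(\mathcal U_i)_{i\in\mathbb N}$ of subsets of $\mathbf C$ such that $\mu(\mathcal U_i)=2^{-i}$ for all $i$ and, for some computably enumerable set $W$ of pairs $(i,w)$, $\mathcal U_i=\bigcup_{(i,w)\in W}[w]$ for all $i$. A sequence $A\in\mathbf C$ is Schnorr random if there is no Schnorr test $(\mathcal U_i)_i$ with $A\in\bigcap_i\mathcal U_i$; let $\mathrm{RAND}_{\mathrm{Schnorr}}$ be the class of all Schnorr random sequences. A class $\mathcal X\subseteq\mathbf C$ is (lightface) $\Pi^0_3$ if there is a decidable predicate $P$ with $A\in\mathcal X\iff\forall k\,\exists l\,\forall m\,P(k,l,A\upharpoonright m)$ for all $A\in\mathbf C$, and it is boldface $\mathbf\Sigma^0_3$ if $\mathcal X=\bigcup_k\bigcap_s\mathcal O_{k,s}$ for some open sets $\mathcal O_{k,s}\subseteq\mathbf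 C$ ($k,s\in\mathbb N$). Theorem. $\mathrm{RAND}_{\mathrm{Schnorr}}$ is a $\Pi^0_3$-class, but it is not a boldface $\mathbf\Sigma^0_3$-class. Moreover, every boldface $\mathbf\Sigma^0_3$-class Wadge reduces to the complement of $\mathrm{RAND}_{\mathrm{Schnorr}}$: for every boldface $\mathbf\Sigma^0_3$-class $\mathcal A\subseteq\mathbf C$ there is a continuous function $f:\mathbf C\to\mathbf C$ such that, for all $X\in\mathbf C$, $X\in\mathcal A\iff f(X)\notin\mathrm{RAND}_{\mathrm{Schnorr}}$. -/

import Mathlib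

open MeasureTheory

/-- The space of infinite binary sequences, with the product topology and product σ-algebra. -/
abbrev CantorSpace : Type := ℕ → Bool

/-- The string `A ↾ n` of the first `n` bits of `A`. -/
def initSeg (A : CantorSpace) (n : ℕ) : List Bool := (List.range n).map A

/-- The basic open set of all sequences that extend the string `w`. -/
def cylinderOf (w : List Bool) : Set CantorSpace := {A | initSeg A w.length = w}

/-- Lebesgue (fair coin) measure on Cantor space: the product of the uniform measures on bits. -/
noncomputable def coinMeasure : Measure CantorSpace :=
  Measure.infinitePi (fun _ : ℕ => (PMF.uniformOfFintype Bool).toMeasure)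

/-- `U` is a uniformly c.e. sequence of open sets: there is one c.e. set of pairs `(i, w)` such
that `U i` is the union of the basic open sets given by the strings `w` enumerated for `i`. -/
def UniformlyCE (U : ℕ → Set CantorSpace) : Prop :=
  ∃ W : ℕ × List Bool → Prop, REPred W ∧
    ∀ i, U i = {A | ∃ w, W (i, w) ∧ A ∈ cylinderOf w}

/-- Schnorr tests: uniformly c.e. sequences of open sets, the `i`-th of measure exactly `2⁻ⁱ`. -/
def IsSchnorrTest (U : ℕ → Set CantorSpace) : Prop :=
  UniformlyCE U ∧ ∀ i, coinMeasure (U i) = (2⁻¹ : ENNReal) ^ i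

/-- A class of sequences is Schnorr null if it is covered by a Schnorr test. -/
def SchnorrNull (𝒜 : Set CantorSpace) : Prop :=
  ∃ U : ℕ → Set CantorSpace, IsSchnorrTest U ∧ 𝒜 ⊆ ⋂ i, U i

/-- The class of Schnorr random sequences. -/
def RandSchnorr : Set CantorSpace := {A | ¬ SchnorrNull {A}}

/-- Lightface `Π⁰₃` classes (arithmetical hierarchy of subsets of Cantor space):
`A ∈ 𝒳 ↔ ∀ k ∃ l ∀ m, P (k, l, A ↾ m)` for a decidable predicate `P`. -/
def IsLightfacePi03 (𝒳 : Set CantorSpace) : Prop :=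
  ∃ P : ℕ × ℕ × List Bool → Prop, ComputablePred P ∧
    ∀ A, A ∈ 𝒳 ↔ ∀ k, ∃ l, ∀ m, P (k, l, initSeg A m)

/-- Boldface `Σ⁰₃` classes (third additive level of the Borel hierarchy): countable unions of
countable intersections of open sets. -/
def IsBoldfaceSigma03 (𝒳 : Set CantorSpace) : Prop :=
  ∃ O : ℕ → ℕ → Set CantorSpace, (∀ k s, IsOpen (O k s)) ∧ 𝒳 = ⋃ k, ⋂ s, O k s

/-- `f` is a Wadge reduction of `𝒜` to `ℬ`. -/
def IsWadgeReduction (f : CantorSpace → CantorSpace) (𝒜 ℬ : Set CantorSpace) : Prop :=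
  Continuous f ∧ 𝒜 = f ⁻¹' ℬ

/-!
A sequence fails to be Schnorr random if and only if *some program `c`* enumerates a sequence of
open sets `enumOpen c i` of measure exactly `2⁻ⁱ` that all contain it. The measure of what has been
enumerated by stage `t` is found by counting strings of length `t`, so that "the `i`-th measure is
`2⁻ⁱ`" and "the sequence lies in all the open sets" are both of the form `∀ ∃` over decidable
conditions. Hence the complement of the class is `Σ⁰₃` (`notMem_randSchnorr_iff_stages`).

The reduction of a `Σ⁰₃` class rests on two facts about single sequences.

* If `n` is computable and monotone and a sequence has `m` zeros from place `n m` on for infinitely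
  many `m`, then it is not Schnorr random (`notMem_randSchnorr_of_windows`). The natural test has
  measures at most `2⁻ⁱ`; since these are computable, it can be padded with initial segments of
  the unit interval to have measures exactly `2⁻ⁱ` (`measure_union_iUnion_padding`).
* There is one capital function `D` on strings that can be kept from growing at each bit, at most
  doubles with each bit, and succeeds on every sequence that is not Schnorr random. Success is at
  one of countably many computable rates `g j`: for infinitely many `r`, the capital is at least
  `2 ^ (r - j)` at length `g j r` (`exists_capital`).

A `Σ⁰₃` class consists of the sequences `X` such that, for some `k`, infinitely many of the clopen
events `E k p` occur at `X` (`exists_events_of_isOpen`). The image of `X` is built in stages. When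
an event for `k` occurs, the image is continued without raising `D` up to a place `n m` and then
by `m` zeros, where `n` is a computable function, depending on `k`, that outgrows `g j` for all
`j < k`, and `m` is large compared with the current value of `D`. If some `k` acts infinitely often,
then the image is not Schnorr random by the first fact. If every `k` acts only finitely often, then
eventually only strategies `k > j` act. Their blocks raise `D` by a factor `2 ^ m`, at lengths where
`g j` asks for a capital of more than `2 ^ (2 * m - j)`. So no rate `g j` is attained infinitely
often, and the image is Schnorr random by the second fact (`exists_reduction_of_events`).

Finally, if the class were boldface `Σ⁰₃`, then by the reductions every boldface `Σ⁰₃` class would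
have a boldface `Σ⁰₃` complement; a diagonal class refutes this.
-/

open Nat.Partrec (Code)
open Encodable (encode)

/-! ### Initial segments and the coin measure -/

theorem length_initSeg (A : CantorSpace) (n : ℕ) : (initSeg A n).length = n := by
  simp [initSeg]

theorem getElem?_initSeg {A : CantorSpace} {n i : ℕ} (h : i < n) :
    (initSeg A n)[i]? = some (A i) := by
  simp [initSeg, h]

theorem initSeg_eq_iff {A : CantorSpace} {n : ℕ} {w : List Bool} :
    initSeg A n = w ↔ w.length = n ∧ ∀ i < n, w[i]? = some (A i) := by
  constructor
  · rintro rfl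
    exact ⟨length_initSeg A n, fun i hi => getElem?_initSeg hi⟩
  · rintro ⟨hl, h⟩
    apply List.ext_getElem?
    intro i
    by_cases hi : i < n
    · rw [getElem?_initSeg hi, h i hi]
    · rw [List.getElem?_eq_none (by rw [length_initSeg]; omega),
        List.getElem?_eq_none (by omega)]

theorem initSeg_congr {A B : CantorSpace} {n : ℕ} :
    initSeg A n = initSeg B n ↔ ∀ i < n, A i = B i := by
  rw [initSeg_eq_iff, length_initSeg]
  refine ⟨fun h i hi => ?_, fun h => ⟨rfl, fun i hi => ?_⟩⟩
  · have := h.2 i hi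
    rw [getElem?_initSeg hi] at this
    simpa using this.symm
  · rw [getElem?_initSeg hi, h i hi]

theorem initSeg_succ (A : CantorSpace) (n : ℕ) : initSeg A (n + 1) = initSeg A n ++ [A n] := by
  simp [initSeg, List.range_succ]

theorem take_initSeg (A : CantorSpace) {m n : ℕ} (h : m ≤ n) :
    (initSeg A n).take m = initSeg A m := by
  rw [initSeg, ← List.map_take, List.take_range, min_eq_left h, initSeg]

theorem mem_cylinderOf {A : CantorSpace} {w : List Bool} :
    A ∈ cylinderOf w ↔ initSeg A w.length = w := Iff.rfl

theorem mem_cylinderOf_initSeg {A B : CantorSpace} {n : ℕ} :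
    A ∈ cylinderOf (initSeg B n) ↔ ∀ i < n, A i = B i := by
  rw [mem_cylinderOf, length_initSeg, initSeg_congr]

/-- Sets that depend only on the first `n` bits are clopen. -/
theorem isClopen_level (p : List Bool → Prop) (n : ℕ) : IsClopen {A | p (initSeg A n)} := by
  have hc : Continuous fun A : CantorSpace => fun i : Fin n => A i := by fun_prop
  have : {A : CantorSpace | p (initSeg A n)} =
      (fun A : CantorSpace => fun i : Fin n => A i) ⁻¹' {x | p (List.ofFn x)} := by
    ext A
    have : initSeg A n = List.ofFn fun i : Fin n => A i := by
      rw [initSeg, List.ofFn_eq_map, ← List.map_coe_finRange_eq_range, List.map_map]; rfl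
    simp [this]
  rw [this]
  exact (isClopen_discrete _).preimage hc

theorem measurableSet_level (p : List Bool → Prop) (n : ℕ) :
    MeasurableSet {A | p (initSeg A n)} :=
  (isClopen_level p n).isOpen.measurableSet

theorem isClopen_cylinderOf (w : List Bool) : IsClopen (cylinderOf w) :=
  isClopen_level (· = w) w.length

instance : IsProbabilityMeasure coinMeasure := by
  unfold coinMeasure; infer_instance

/-- Prescribing the bits at finitely many places `s` has probability `2⁻ˢ`. -/
theorem coinMeasure_agree (s : Finset ℕ) (b : ℕ → Bool) :
    coinMeasure {A | ∀ i ∈ s, A i = b i} = (2⁻¹ : ENNReal) ^ s.card := by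
  have : {A : CantorSpace | ∀ i ∈ s, A i = b i} = Set.pi s (fun i => {b i}) := by
    ext A; simp [Set.mem_pi]
  rw [this, coinMeasure, Measure.infinitePi_pi _ (fun i _ => MeasurableSet.singleton _)]
  simp [PMF.uniformOfFintype_apply]

theorem coinMeasure_cylinderOf (w : List Bool) :
    coinMeasure (cylinderOf w) = (2⁻¹ : ENNReal) ^ w.length := by
  have := coinMeasure_agree (Finset.range w.length) (fun i => w.getD i false)
  rw [Finset.card_range] at this
  rw [← this]
  congr 1
  ext A
  simp only [mem_cylinderOf, initSeg_eq_iff, Finset.mem_range, Set.mem_ofPred_eq, true_and]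
  refine forall₂_congr fun i hi => ?_
  simp [hi, eq_comm]

theorem coinMeasure_real_cylinderOf (w : List Bool) :
    coinMeasure.real (cylinderOf w) = (1 / 2 : ℝ) ^ w.length := by
  simp [Measure.real, coinMeasure_cylinderOf]

/-! ### Counting strings -/

/-- The list of all binary strings of length `n`. -/
def strs (n : ℕ) : List (List Bool) :=
  Nat.rec [[]] (fun _ l => l.map (List.cons true) ++ l.map (List.cons false)) n

theorem mem_strs {n : ℕ} {w : List Bool} : w ∈ strs n ↔ w.length = n := by
  induction n generalizing w with
  | zero => simp [strs]
  | succ n ih =>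
    change w ∈ (strs n).map (List.cons true) ++ (strs n).map (List.cons false) ↔ _
    cases w with
    | nil => simp
    | cons b w => cases b <;> simp [ih]

theorem nodup_strs (n : ℕ) : (strs n).Nodup := by
  induction n with
  | zero => simp [strs]
  | succ n ih =>
    change ((strs n).map (List.cons true) ++ (strs n).map (List.cons false)).Nodup
    refine List.Nodup.append (ih.map (List.cons_injective)) (ih.map (List.cons_injective)) ?_
    intro w h1 h2
    simp only [List.mem_map] at h1 h2
    obtain ⟨a, -, rfl⟩ := h1
    obtain ⟨b, -, h⟩ := h2
    simp at h

theorem primrec_strs : Primrec strs := by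
  refine Primrec.nat_rec' (f := fun n : ℕ => n) (g := fun _ => [[]])
    (h := fun _ p => p.2.map (List.cons true) ++ p.2.map (List.cons false))
    Primrec.id (Primrec.const _) ?_
  have h : Primrec fun q : ℕ × ℕ × List (List Bool) => q.2.2 := Primrec.snd.comp Primrec.snd
  exact Primrec.list_append.comp
    (Primrec.list_map h (Primrec.list_cons.comp (Primrec.const true) Primrec.snd))
    (Primrec.list_map h (Primrec.list_cons.comp (Primrec.const false) Primrec.snd))

open Classical in
/-- The number of strings of length `n` satisfying `p`. -/
noncomputable def levelCount (p : List Bool → Prop) (n : ℕ) : ℕ :=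
  ((strs n).filter (p ·)).length

/-- The measure of a set decided by the first `n` bits is computed by counting strings. -/
theorem coinMeasure_real_level (p : List Bool → Prop) (n : ℕ) :
    coinMeasure.real {A | p (initSeg A n)} = levelCount p n / 2 ^ n := by
  classical
  have h : {A | p (initSeg A n)} =
      ⋃ w ∈ ((strs n).filter (p ·)).toFinset, cylinderOf w := by
    ext A
    simp only [Set.mem_ofPred_eq, List.mem_toFinset, List.mem_filter, mem_strs,
      decide_eq_true_eq, Set.mem_iUnion, exists_prop, mem_cylinderOf]
    constructor
    · intro h
      exact ⟨initSeg A n, ⟨length_initSeg A n, h⟩, by rw [length_initSeg]⟩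
    · rintro ⟨w, ⟨rfl, h⟩, h'⟩
      rwa [h']
  rw [h, measureReal_biUnion_finset]
  · rw [Finset.sum_congr rfl (g := fun _ => (1 / 2 : ℝ) ^ n)]
    · rw [Finset.sum_const, List.toFinset_card_of_nodup ((nodup_strs n).filter _), levelCount,
        nsmul_eq_mul, one_div, inv_pow, div_eq_mul_inv]
    · intro w hw
      simp only [List.mem_toFinset, List.mem_filter, mem_strs] at hw
      rw [coinMeasure_real_cylinderOf, hw.1]
  · intro v hv w hw hne
    simp only [List.coe_toFinset, List.mem_filter, mem_strs, Set.mem_ofPred_eq] at hv hw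
    refine Set.disjoint_left.2 fun A h1 h2 => hne ?_
    rw [mem_cylinderOf] at h1 h2
    rw [← h1, ← h2, hv.1, hw.1]
  · exact fun w _ => (isClopen_cylinderOf w).isOpen.measurableSet

theorem primrec_levelCount {α : Type*} [Primcodable α] {R : List Bool → α → Prop}
    (hR : PrimrecRel R) : Primrec fun q : α × ℕ => levelCount (R · q.1) q.2 := by
  classical
  refine (Primrec.list_length.comp (hR.listFilter.comp (primrec_strs.comp Primrec.snd)
    Primrec.fst)).of_eq fun q => ?_
  simp [levelCount]

/-! ### Stages of an enumeration -/

/-- The `i`-th member of the sequence of open sets enumerated by the program `c`: the program is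
read as a semidecision procedure for pairs `(i, w)`. -/
def enumOpen (c : Code) (i : ℕ) : Set CantorSpace :=
  {A | ∃ n, (c.eval (encode (i, initSeg A n))).Dom}

/-- Some prefix of `σ` of length at most `t` is put into the `i`-th open set within `t` steps. -/
def stageHit (c : Code) (i t : ℕ) (σ : List Bool) : Prop :=
  ∃ n < t + 1, (c.evaln t (encode (i, σ.take n))).isSome

/-- The part of `enumOpen c i` enumerated by stage `t` through strings of length at most `t`. -/
def enumStage (c : Code) (i t : ℕ) : Set CantorSpace :=
  {A | stageHit c i t (initSeg A t)}

theorem mem_enumStage {c : Code} {i t : ℕ} {A : CantorSpace} :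
    A ∈ enumStage c i t ↔ ∃ n ≤ t, (c.evaln t (encode (i, initSeg A n))).isSome := by
  unfold enumStage stageHit
  simp only [Set.mem_ofPred_eq, Nat.lt_succ_iff]
  refine exists_congr fun n => and_congr_right fun hn => ?_
  rw [take_initSeg A hn]

theorem enumStage_mono (c : Code) (i : ℕ) : Monotone (enumStage c i) := by
  intro s t hst A hA
  rw [mem_enumStage] at hA ⊢
  obtain ⟨n, hn, h⟩ := hA
  obtain ⟨x, hx⟩ := Option.isSome_iff_exists.1 h
  exact ⟨n, hn.trans hst, Option.isSome_iff_exists.2 ⟨x, Code.evaln_mono hst hx⟩⟩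

theorem enumOpen_eq_iUnion (c : Code) (i : ℕ) : enumOpen c i = ⋃ t, enumStage c i t := by
  ext A
  simp only [enumOpen, Set.mem_ofPred_eq, Set.mem_iUnion, mem_enumStage]
  constructor
  · rintro ⟨n, h⟩
    obtain ⟨x, hx⟩ := Part.dom_iff_mem.1 h
    obtain ⟨k, hk⟩ := Code.evaln_complete.1 hx
    exact ⟨max n k, n, le_max_left _ _,
      Option.isSome_iff_exists.2 ⟨x, Code.evaln_mono (le_max_right _ _) hk⟩⟩
  · rintro ⟨t, n, -, h⟩
    obtain ⟨x, hx⟩ := Option.isSome_iff_exists.1 h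
    exact ⟨n, Part.dom_iff_mem.2 ⟨x, Code.evaln_sound hx⟩⟩

theorem enumStage_subset (c : Code) (i t : ℕ) : enumStage c i t ⊆ enumOpen c i := by
  rw [enumOpen_eq_iUnion]
  exact Set.subset_iUnion _ t

theorem measurableSet_enumStage (c : Code) (i t : ℕ) : MeasurableSet (enumStage c i t) :=
  measurableSet_level _ _

theorem tendsto_enumStage (c : Code) (i : ℕ) :
    Filter.Tendsto (fun t => coinMeasure.real (enumStage c i t)) Filter.atTop
      (nhds (coinMeasure.real (enumOpen c i))) := by
  have h := tendsto_measure_iUnion_atTop (μ := coinMeasure) (enumStage_mono c i)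
  rw [← enumOpen_eq_iUnion] at h
  exact (ENNReal.tendsto_toReal (measure_ne_top _ _)).comp h

theorem primrecPred_stageHit :
    PrimrecPred fun q : (Code × ℕ) × ℕ × List Bool => stageHit q.1.1 q.1.2 q.2.1 q.2.2 := by
  have hR : PrimrecRel fun (n : ℕ) (q : (Code × ℕ) × ℕ × List Bool) =>
      (q.1.1.evaln q.2.1 (encode (q.1.2, q.2.2.take n))).isSome = true := by
    have h := Primrec.snd (α := ℕ) (β := (Code × ℕ) × ℕ × List Bool)
    have h21 := Primrec.fst.comp (Primrec.snd.comp h)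
    have h11 := Primrec.fst.comp (Primrec.fst.comp h)
    have h12 := Primrec.snd.comp (Primrec.fst.comp h)
    have h22 := Primrec.snd.comp (Primrec.snd.comp h)
    have he := Code.primrec_evaln.comp (Primrec.pair (Primrec.pair h21 h11)
      (Primrec.encode.comp (Primrec.pair h12 (Primrec.list_take.comp Primrec.fst h22))))
    exact Primrec.eq.comp (Primrec.option_isSome.comp he) (Primrec.const true)
  have ht : Primrec fun q : (Code × ℕ) × ℕ × List Bool => q.2.1 + 1 :=
    Primrec.succ.comp (Primrec.fst.comp Primrec.snd)
  refine (hR.exists_mem_list.comp (Primrec.list_range.comp ht) Primrec.id).of_eq fun q => ?_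
  simp [stageHit]

/-- The number of strings of length `t` that lie in `enumStage c i t`. -/
noncomputable def stageCount (c : Code) (i t : ℕ) : ℕ := levelCount (stageHit c i t) t

theorem primrec_stageCount :
    Primrec fun q : (Code × ℕ) × ℕ => stageCount q.1.1 q.1.2 q.2 := by
  have hR : PrimrecRel fun (w : List Bool) (q : (Code × ℕ) × ℕ) =>
      stageHit q.1.1 q.1.2 q.2 w := by
    refine primrecPred_stageHit.comp (Primrec.pair (Primrec.fst.comp Primrec.snd)
      (Primrec.pair (Primrec.snd.comp Primrec.snd) Primrec.fst))
  exact (primrec_levelCount hR).comp (Primrec.pair Primrec.id Primrec.snd)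

theorem real_enumStage (c : Code) (i t : ℕ) :
    coinMeasure.real (enumStage c i t) = stageCount c i t / 2 ^ t :=
  coinMeasure_real_level _ _

/-- The stage `t` has exhausted the `i`-th open set up to `2⁻ʲ`, provided that this set has
measure at most `2⁻ⁱ`; written without division. -/
def StageFull (c : Code) (i j t : ℕ) : Prop :=
  2 ^ (t + j) < stageCount c i t * 2 ^ (i + j) + 2 ^ (t + i)

theorem stageFull_iff {c : Code} {i j t : ℕ} :
    StageFull c i j t ↔ (1 / 2 : ℝ) ^ i < coinMeasure.real (enumStage c i t) + (1 / 2) ^ j := by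
  rw [real_enumStage, StageFull, ← @Nat.cast_lt ℝ]
  push_cast
  rw [← mul_lt_mul_iff_right₀ (b := (1 / 2 : ℝ) ^ i)
    (show (0 : ℝ) < 2 ^ (t + i + j) by positivity)]
  have h1 : (2 : ℝ) ^ (t + i + j) * (1 / 2) ^ i = 2 ^ (t + j) := by
    rw [one_div, inv_pow]; field_simp; ring
  have h2 : (2 : ℝ) ^ (t + i + j) * (stageCount c i t / 2 ^ t + (1 / 2) ^ j) =
      stageCount c i t * 2 ^ (i + j) + 2 ^ (t + i) := by
    rw [one_div, inv_pow]; field_simp; ring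
  rw [h1, h2]

theorem Primrec.nat_pow_two {α : Type*} [Primcodable α] {f : α → ℕ} (hf : Primrec f) :
    Primrec fun a => 2 ^ f a := by
  have h : Primrec fun n : ℕ => 2 ^ n := by
    refine (Primrec.nat_rec' (f := fun n : ℕ => n) (g := fun _ => 1) (h := fun _ p => 2 * p.2)
      Primrec.id (Primrec.const 1) (Primrec.nat_mul.comp (Primrec.const 2)
        (Primrec.snd.comp Primrec.snd))).of_eq fun n => ?_
    induction n with
    | zero => rfl
    | succ n ih => simp only at ih ⊢; rw [ih]; ring
  exact h.comp hf

theorem primrecPred_stageFull :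
    PrimrecPred fun q : (Code × ℕ) × ℕ × ℕ => StageFull q.1.1 q.1.2 q.2.1 q.2.2 := by
  have hc := Primrec.fst.comp (Primrec.fst (α := Code × ℕ) (β := ℕ × ℕ))
  have hi := Primrec.snd.comp (Primrec.fst (α := Code × ℕ) (β := ℕ × ℕ))
  have hj := Primrec.fst.comp (Primrec.snd (α := Code × ℕ) (β := ℕ × ℕ))
  have ht := Primrec.snd.comp (Primrec.snd (α := Code × ℕ) (β := ℕ × ℕ))
  have hs := primrec_stageCount.comp (Primrec.pair (Primrec.pair hc hi) ht)
  exact Primrec.nat_lt.comp (Primrec.nat_pow_two (Primrec.nat_add.comp ht hj))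
    (Primrec.nat_add.comp
      (Primrec.nat_mul.comp hs (Primrec.nat_pow_two (Primrec.nat_add.comp hi hj)))
      (Primrec.nat_pow_two (Primrec.nat_add.comp ht hi)))

theorem REPred.exists_code {α : Type*} [Primcodable α] {p : α → Prop} (hp : REPred p) :
    ∃ c : Code, ∀ a, (c.eval (encode a)).Dom ↔ p a := by
  obtain ⟨c, hc⟩ := Code.exists_code.1 hp
  refine ⟨c, fun a => ?_⟩
  rw [hc]
  simp [Part.assert]

theorem UniformlyCE.exists_code {U : ℕ → Set CantorSpace} (hU : UniformlyCE U) :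
    ∃ c : Code, U = enumOpen c := by
  obtain ⟨W, hW, hU⟩ := hU
  obtain ⟨c, hc⟩ := hW.exists_code
  refine ⟨c, funext fun i => ?_⟩
  rw [hU i]
  ext A
  simp only [enumOpen, Set.mem_ofPred_eq, hc, mem_cylinderOf]
  constructor
  · rintro ⟨w, h, hw⟩
    exact ⟨w.length, by rwa [hw]⟩
  · rintro ⟨n, h⟩
    exact ⟨initSeg A n, h, by rw [length_initSeg]⟩

theorem uniformlyCE_enumOpen (c : Code) : UniformlyCE (enumOpen c) := by
  refine ⟨fun a => (c.eval (encode a)).Dom, ?_, fun i => ?_⟩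
  · exact Partrec.dom_re (Code.eval_part.comp (Computable.const c) Computable.encode)
  · ext A
    simp only [enumOpen, Set.mem_ofPred_eq, mem_cylinderOf]
    constructor
    · rintro ⟨n, h⟩
      exact ⟨initSeg A n, h, by rw [length_initSeg]⟩
    · rintro ⟨w, h, hw⟩
      exact ⟨w.length, by rwa [hw]⟩

theorem measure_eq_two_inv_pow_iff {S : Set CantorSpace} {i : ℕ} :
    coinMeasure S = (2⁻¹ : ENNReal) ^ i ↔ coinMeasure.real S = (1 / 2 : ℝ) ^ i := by
  rw [Measure.real, ← ENNReal.toReal_eq_toReal_iff' (measure_ne_top _ _)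
    (ENNReal.pow_ne_top (by simp))]
  simp

theorem notMem_randSchnorr_iff {A : CantorSpace} :
    A ∉ RandSchnorr ↔ ∃ c : Code, (∀ i, coinMeasure.real (enumOpen c i) = (1 / 2 : ℝ) ^ i) ∧
      ∀ i, A ∈ enumOpen c i := by
  simp only [RandSchnorr, SchnorrNull, Set.mem_ofPred_eq, not_not, Set.singleton_subset_iff,
    Set.mem_iInter, ← measure_eq_two_inv_pow_iff]
  constructor
  · rintro ⟨U, ⟨hU, hm⟩, hA⟩
    obtain ⟨c, rfl⟩ := hU.exists_code
    exact ⟨c, hm, hA⟩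
  · rintro ⟨c, hm, hA⟩
    exact ⟨_, ⟨uniformlyCE_enumOpen c, hm⟩, hA⟩

/-! ### The class of Schnorr random sequences is `Π⁰₃` -/

theorem exists_stageFull {c : Code} {i : ℕ} (h : (1 / 2 : ℝ) ^ i ≤ coinMeasure.real (enumOpen c i))
    (j : ℕ) : ∃ t, StageFull c i j t := by
  have h1 : (1 / 2 : ℝ) ^ i - (1 / 2) ^ j < coinMeasure.real (enumOpen c i) :=
    lt_of_lt_of_le (sub_lt_self _ (by positivity)) h
  obtain ⟨t, ht⟩ := ((tendsto_enumStage c i).eventually (lt_mem_nhds h1)).exists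
  exact ⟨t, stageFull_iff.2 (by linarith)⟩

theorem StageFull.mono {c : Code} {i j s t : ℕ} (hst : s ≤ t) (h : StageFull c i j s) :
    StageFull c i j t := by
  rw [stageFull_iff] at h ⊢
  have := measureReal_mono (μ := coinMeasure) (enumStage_mono c i hst)
  linarith

/-- Membership in a Schnorr test in `∃∀∃` form. The upper bound on the measure of `enumOpen c i`
is checked stage by stage, the lower bound and the membership at a late stage `m`. -/
theorem notMem_randSchnorr_iff_stages {A : CantorSpace} :
    A ∉ RandSchnorr ↔ ∃ c : Code, ∀ i j, ∃ m, stageCount c i j * 2 ^ i ≤ 2 ^ j ∧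
      StageFull c i j m ∧ A ∈ enumStage c i m := by
  have key : ∀ c i j, stageCount c i j * 2 ^ i ≤ 2 ^ j ↔
      coinMeasure.real (enumStage c i j) ≤ (1 / 2 : ℝ) ^ i := by
    intro c i j
    rw [real_enumStage, ← @Nat.cast_le ℝ, one_div, inv_pow, div_le_iff₀ (by positivity),
      inv_mul_eq_div, le_div_iff₀ (by positivity)]
    push_cast
    rfl
  rw [notMem_randSchnorr_iff]
  refine exists_congr fun c => ⟨fun ⟨hm, hA⟩ i j => ?_, fun h => ⟨fun i => le_antisymm ?_ ?_, ?_⟩⟩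
  · obtain ⟨t, ht⟩ := exists_stageFull (hm i).ge j
    have hAi := hA i
    rw [enumOpen_eq_iUnion, Set.mem_iUnion] at hAi
    obtain ⟨s, hs⟩ := hAi
    refine ⟨max s t, (key c i j).2 ?_, ht.mono (le_max_right _ _),
      enumStage_mono c i (le_max_left _ _) hs⟩
    rw [← hm i]
    exact measureReal_mono (enumStage_subset c i j)
  · refine le_of_tendsto' (tendsto_enumStage c i) fun j => ?_
    obtain ⟨m, h1, -⟩ := h i j
    exact (key c i j).1 h1
  · have hlim : Filter.Tendsto (fun j : ℕ => coinMeasure.real (enumOpen c i) + (1 / 2 : ℝ) ^ j)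
        Filter.atTop (nhds (coinMeasure.real (enumOpen c i) + 0)) :=
      tendsto_const_nhds.add (tendsto_pow_atTop_nhds_zero_of_lt_one (by norm_num) (by norm_num))
    rw [add_zero] at hlim
    refine ge_of_tendsto' hlim fun j => ?_
    obtain ⟨m, -, h2, -⟩ := h i j
    have := measureReal_mono (μ := coinMeasure) (enumStage_subset c i m)
    exact ((stageFull_iff.1 h2).trans_le (by linarith)).le
  · intro i
    obtain ⟨m, -, -, h3⟩ := h i 0
    exact enumStage_subset c i m h3

theorem isLightfacePi03_randSchnorr : IsLightfacePi03 RandSchnorr := by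
  let Q : (Code × ℕ × ℕ) × List Bool → Prop := fun q =>
    stageCount q.1.1 q.1.2.1 q.1.2.2 * 2 ^ q.1.2.1 ≤ 2 ^ q.1.2.2 ∧
      StageFull q.1.1 q.1.2.1 q.1.2.2 q.2.length ∧ stageHit q.1.1 q.1.2.1 q.2.length q.2
  have hQ : PrimrecPred Q := by
    have h := Primrec.fst (α := Code × ℕ × ℕ) (β := List Bool)
    have hσ := Primrec.snd (α := Code × ℕ × ℕ) (β := List Bool)
    have hc := Primrec.fst.comp h
    have hi := Primrec.fst.comp (Primrec.snd.comp h)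
    have hj := Primrec.snd.comp (Primrec.snd.comp h)
    have hl := Primrec.list_length.comp hσ
    refine PrimrecPred.and ?_ (PrimrecPred.and ?_ ?_)
    · exact Primrec.nat_le.comp (Primrec.nat_mul.comp
        (primrec_stageCount.comp (Primrec.pair (Primrec.pair hc hi) hj))
        (Primrec.nat_pow_two hi)) (Primrec.nat_pow_two hj)
    · exact primrecPred_stageFull.comp
        (Primrec.pair (Primrec.pair hc hi) (Primrec.pair hj hl))
    · exact primrecPred_stageHit.comp
        (Primrec.pair (Primrec.pair hc hi) (Primrec.pair hl hσ))
  refine ⟨fun q => ¬ Q ((Denumerable.ofNat Code q.1, Nat.unpair q.2.1), q.2.2), ?_, fun A => ?_⟩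
  · have : PrimrecPred fun q : ℕ × ℕ × List Bool =>
        ¬ Q ((Denumerable.ofNat Code q.1, Nat.unpair q.2.1), q.2.2) :=
      (hQ.comp (Primrec.pair (Primrec.pair ((Primrec.ofNat Code).comp Primrec.fst)
        (Primrec.unpair.comp (Primrec.fst.comp Primrec.snd)))
          (Primrec.snd.comp Primrec.snd))).not
    obtain ⟨hd, hp⟩ := this
    exact ⟨hd, hp.to_comp⟩
  · rw [← not_iff_not, notMem_randSchnorr_iff_stages]
    push Not
    simp only [Q, length_initSeg]
    constructor
    · rintro ⟨c, h⟩
      refine ⟨encode c, fun l => ?_⟩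
      rw [Denumerable.ofNat_encode]
      exact h _ _
    · rintro ⟨k, h⟩
      refine ⟨Denumerable.ofNat Code k, fun i j => ?_⟩
      have := h (Nat.pair i j)
      rw [Nat.unpair_pair] at this
      exact this

/-! ### Tests with clopen components and the associated capital function -/

theorem PrimrecRel.exists_computable_choice {R : ℕ → ℕ → Prop} (hR : PrimrecRel R)
    (h : ∀ n, ∃ t, R n t) : ∃ f : ℕ → ℕ, Computable f ∧ ∀ n, R n (f n) := by
  classical
  refine ⟨fun n => Nat.find (h n), ?_, fun n => Nat.find_spec (h n)⟩
  have hp : Partrec₂ fun n t : ℕ => (Part.some (decide (R n t)) : Part Bool) :=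
    (PrimrecRel.decide hR).to_comp.partrec₂
  refine (Partrec.rfind hp).of_eq_tot fun n => ?_
  refine Nat.mem_rfind.2 ⟨by simpa using Nat.find_spec (h n), fun {m} hm => ?_⟩
  simpa using Nat.find_min (h n) hm

theorem Computable.exists_strictMono_ge {f : ℕ → ℕ} (hf : Computable f) :
    ∃ g : ℕ → ℕ, Computable g ∧ StrictMono g ∧ ∀ n, f n ≤ g n := by
  let g : ℕ → ℕ := fun n => Nat.rec (f 0) (fun m x => x + f (m + 1) + 1) n
  have hs : ∀ n, g (n + 1) = g n + f (n + 1) + 1 := fun _ => rfl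
  refine ⟨g, ?_, strictMono_nat_of_lt_succ fun n => by rw [hs]; omega, fun n => ?_⟩
  · refine Computable.nat_rec (f := fun n : ℕ => n) (g := fun _ => f 0)
      (h := fun _ p => p.2 + f (p.1 + 1) + 1) Computable.id (Computable.const _) ?_
    have h1 : Computable fun q : ℕ × ℕ × ℕ => q.2.1 := Computable.fst.comp Computable.snd
    have h2 : Computable fun q : ℕ × ℕ × ℕ => q.2.2 := Computable.snd.comp Computable.snd
    exact Computable.succ.comp (Primrec.nat_add.to_comp.comp h2
      (hf.comp (Computable.succ.comp h1)))
  · cases n with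
    | zero => exact le_rfl
    | succ n => rw [hs]; omega

theorem real_diff_le_of_stageFull {c : Code} {i j t : ℕ}
    (hm : coinMeasure.real (enumOpen c i) = (1 / 2 : ℝ) ^ i) (h : StageFull c i j t) :
    coinMeasure.real (enumOpen c i \ enumStage c i t) ≤ (1 / 2 : ℝ) ^ j := by
  rw [measureReal_sdiff (enumStage_subset c i t) (measurableSet_enumStage c i t), hm]
  linarith [stageFull_iff.1 h]

/-- A Schnorr test can be replaced by a sequence of clopen sets of rapidly decreasing measure such
that every sequence covered by the test lies in infinitely many of them. The `r`-th set depends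
on the first `g r` bits only, where `g` is computable. It consists of the part of the `2r`-th
component enumerated by stage `g r`, together with what the previous components have enumerated
since stage `g (r - 1)`. -/
theorem exists_clopen_test {c : Code}
    (hm : ∀ i, coinMeasure.real (enumOpen c i) = (1 / 2 : ℝ) ^ i) :
    ∃ (g : ℕ → ℕ) (V : ℕ → Set CantorSpace), Computable g ∧ StrictMono g ∧
      (∀ r, MeasurableSet (V r)) ∧ (∀ r, coinMeasure.real (V r) ≤ 2 * (1 / 4 : ℝ) ^ r) ∧
      (∀ r, ∀ A ∈ V r, cylinderOf (initSeg A (g r)) ⊆ V r) ∧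
      ∀ A, (∀ i, A ∈ enumOpen c i) → ∀ R, ∃ r ≥ R, A ∈ V r := by
  -- The bound `16⁻⁽ʳ⁺¹⁾` on what is missing leaves room for the `r + 1` differences in `V (r + 1)`.
  have hex : ∀ r, ∃ t, ∀ i < r + 1, StageFull c (2 * i) (4 * (r + 1)) t := by
    intro r
    choose t ht using fun i => exists_stageFull (hm (2 * i)).ge (4 * (r + 1))
    refine ⟨(Finset.range (r + 1)).sup t, fun i hi => (ht i).mono ?_⟩
    exact Finset.le_sup (f := t) (Finset.mem_range.2 hi)
  have hR : PrimrecRel fun r t : ℕ => ∀ i < r + 1, StageFull c (2 * i) (4 * (r + 1)) t := by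
    have hS : PrimrecRel fun (i : ℕ) (q : ℕ × ℕ) => StageFull c (2 * i) (4 * (q.1 + 1)) q.2 := by
      have hi := Primrec.fst (α := ℕ) (β := ℕ × ℕ)
      have hr := Primrec.fst.comp (Primrec.snd (α := ℕ) (β := ℕ × ℕ))
      have ht := Primrec.snd.comp (Primrec.snd (α := ℕ) (β := ℕ × ℕ))
      exact primrecPred_stageFull.comp (Primrec.pair
        (Primrec.pair (Primrec.const c) (Primrec.nat_mul.comp (Primrec.const 2) hi))
        (Primrec.pair (Primrec.nat_mul.comp (Primrec.const 4) (Primrec.succ.comp hr)) ht))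
    refine (hS.forall_mem_list.comp (Primrec.list_range.comp (Primrec.succ.comp Primrec.fst))
      Primrec.id).of_eq fun q => ?_
    simp
  obtain ⟨f, hf, hfR⟩ := hR.exists_computable_choice hex
  obtain ⟨g, hg, hgm, hfg⟩ := hf.exists_strictMono_ge
  have hfull : ∀ r, ∀ i ≤ r, StageFull c (2 * i) (4 * (r + 1)) (g r) := fun r i hi =>
    (hfR r i (Nat.lt_succ_of_le hi)).mono (hfg r)
  let V : ℕ → Set CantorSpace := fun r => enumStage c (2 * r) (g r) ∪
    ⋃ i ∈ Finset.range r, (enumStage c (2 * i) (g r) \ enumStage c (2 * i) (g (r - 1)))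
  refine ⟨g, V, hg, hgm, fun r => ?_, fun r => ?_, fun r A hA B hB => ?_, fun A hA R => ?_⟩
  · refine (measurableSet_enumStage _ _ _).union (Finset.measurableSet_biUnion _ fun i _ => ?_)
    exact (measurableSet_enumStage _ _ _).diff (measurableSet_enumStage _ _ _)
  · have h1 : coinMeasure.real (enumStage c (2 * r) (g r)) ≤ (1 / 4 : ℝ) ^ r := by
      refine (measureReal_mono (enumStage_subset c (2 * r) (g r))).trans_eq ?_
      rw [hm, pow_mul]; norm_num
    have h2 : ∀ i ∈ Finset.range r, coinMeasure.real
        (enumStage c (2 * i) (g r) \ enumStage c (2 * i) (g (r - 1))) ≤ (1 / 16 : ℝ) ^ r := by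
      intro i hi
      have hir := Finset.mem_range.1 hi
      have := real_diff_le_of_stageFull (hm (2 * i)) (hfull (r - 1) i (by omega))
      rw [Nat.sub_add_cancel (by omega), pow_mul] at this
      refine (measureReal_mono ?_).trans (this.trans_eq (by norm_num))
      exact Set.sdiff_subset_sdiff_left (enumStage_subset _ _ _)
    have h3 : (r : ℝ) * (1 / 16) ^ r ≤ (1 / 4) ^ r := by
      have : (r : ℝ) ≤ 4 ^ r := by exact_mod_cast (Nat.lt_pow_self (by norm_num)).le
      calc (r : ℝ) * (1 / 16) ^ r ≤ 4 ^ r * (1 / 16) ^ r := by gcongr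
        _ = (1 / 4) ^ r := by rw [← mul_pow]; norm_num
    calc coinMeasure.real (V r) ≤ _ := measureReal_union_le _ _
      _ ≤ (1 / 4 : ℝ) ^ r + ∑ i ∈ Finset.range r, (1 / 16 : ℝ) ^ r := by
          gcongr
          exact (measureReal_biUnion_finset_le _ _).trans (Finset.sum_le_sum h2)
      _ ≤ 2 * (1 / 4 : ℝ) ^ r := by
          rw [Finset.sum_const, Finset.card_range, nsmul_eq_mul]; linarith
  · have hBA : ∀ i < g r, B i = A i := mem_cylinderOf_initSeg.1 hB
    have key : ∀ i t, t ≤ g r → (B ∈ enumStage c i t ↔ A ∈ enumStage c i t) := by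
      intro i t ht
      have : initSeg B t = initSeg A t := initSeg_congr.2 fun k hk => hBA k (hk.trans_le ht)
      simp only [enumStage, Set.mem_ofPred_eq, this]
    have hle : g (r - 1) ≤ g r := hgm.monotone (Nat.sub_le r 1)
    simpa only [V, Set.mem_union, Set.mem_iUnion, Set.mem_sdiff, key _ _ le_rfl, key _ _ hle]
      using hA
  · classical
    have hs : ∃ r, R ≤ r ∧ A ∈ enumStage c (2 * R) (g r) := by
      have := hA (2 * R)
      rw [enumOpen_eq_iUnion, Set.mem_iUnion] at this
      obtain ⟨t, ht⟩ := this
      exact ⟨max R t, le_max_left _ _, enumStage_mono _ _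
        ((le_max_right R t).trans (hgm.id_le _)) ht⟩
    obtain ⟨h1, h2⟩ := Nat.find_spec hs
    refine ⟨Nat.find hs, h1, ?_⟩
    rcases h1.eq_or_lt with h | h
    · left
      rwa [← h] at h2 ⊢
    · right
      simp only [Set.mem_iUnion]
      refine ⟨R, Finset.mem_range.2 h, h2, fun h3 => ?_⟩
      exact Nat.find_min hs (m := Nat.find hs - 1) (by omega) ⟨by omega, h3⟩

/-- All Schnorr tests at once, in clopen form. -/
theorem exists_clopen_tests :
    ∃ (g : ℕ → ℕ → ℕ) (V : ℕ → ℕ → Set CantorSpace), (∀ j, Computable (g j)) ∧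
      (∀ j, StrictMono (g j)) ∧ (∀ j r, MeasurableSet (V j r)) ∧
      (∀ j r, coinMeasure.real (V j r) ≤ 2 * (1 / 4 : ℝ) ^ r) ∧
      (∀ j r, ∀ A ∈ V j r, cylinderOf (initSeg A (g j r)) ⊆ V j r) ∧
      ∀ A ∉ RandSchnorr, ∃ j, ∀ R, ∃ r ≥ R, A ∈ V j r := by
  have h : ∀ j : ℕ, ∃ (g : ℕ → ℕ) (V : ℕ → Set CantorSpace), Computable g ∧ StrictMono g ∧
      (∀ r, MeasurableSet (V r)) ∧ (∀ r, coinMeasure.real (V r) ≤ 2 * (1 / 4 : ℝ) ^ r) ∧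
      (∀ r, ∀ A ∈ V r, cylinderOf (initSeg A (g r)) ⊆ V r) ∧
      ((∀ i, coinMeasure.real (enumOpen (Denumerable.ofNat Code j) i) = (1 / 2 : ℝ) ^ i) →
        ∀ A, (∀ i, A ∈ enumOpen (Denumerable.ofNat Code j) i) → ∀ R, ∃ r ≥ R, A ∈ V r) := by
    intro j
    by_cases hm : ∀ i, coinMeasure.real (enumOpen (Denumerable.ofNat Code j) i) = (1 / 2 : ℝ) ^ i
    · obtain ⟨g, V, h1, h2, h3, h4, h5, h6⟩ := exists_clopen_test hm
      exact ⟨g, V, h1, h2, h3, h4, h5, fun _ => h6⟩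
    · exact ⟨id, fun _ => ∅, Computable.id, strictMono_id, fun _ => MeasurableSet.empty,
        fun r => by rw [measureReal_empty]; positivity, fun _ _ h => h.elim,
        fun h => (hm h).elim⟩
  choose g V h1 h2 h3 h4 h5 h6 using h
  refine ⟨g, V, h1, h2, h3, h4, h5, fun A hA => ?_⟩
  obtain ⟨c, hm, hA⟩ := notMem_randSchnorr_iff.1 hA
  refine ⟨encode c, h6 _ ?_ A ?_⟩ <;> rwa [Denumerable.ofNat_encode]

/-- A capital function, of which only the two inequalities on martingales used below are recorded,
that succeeds at a computable rate on every sequence that is not Schnorr random. It is the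
density, with respect to the coin measure, of the sum of the restrictions of the coin measure to
the sets `V j r` of the clopen tests, with weights `2 ^ r / 2 ^ j`. -/
theorem exists_capital :
    ∃ (g : ℕ → ℕ → ℕ) (D : List Bool → ℝ), (∀ j, Computable (g j)) ∧ (∀ j, StrictMono (g j)) ∧
      (∀ σ, 0 ≤ D σ) ∧ (∀ σ, ∃ b, D (σ ++ [b]) ≤ D σ) ∧ (∀ σ b, D (σ ++ [b]) ≤ 2 * D σ) ∧
      ∀ A ∉ RandSchnorr, ∃ j, ∀ R, ∃ r ≥ R, 2 ^ r ≤ 2 ^ j * D (initSeg A (g j r)) := by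
  obtain ⟨g, V, hg, hgm, hV, hVm, hVc, hVr⟩ := exists_clopen_tests
  let ν : Measure CantorSpace := Measure.sum fun p : ℕ × ℕ =>
    ((2⁻¹ : ENNReal) ^ p.1 * 2 ^ p.2) • coinMeasure.restrict (V p.1 p.2)
  have hν : ν Set.univ ≠ ⊤ := by
    have hle : ∀ p : ℕ × ℕ, (((2⁻¹ : ENNReal) ^ p.1 * 2 ^ p.2) •
        coinMeasure.restrict (V p.1 p.2)) Set.univ ≤ (2⁻¹ : ENNReal) ^ p.1 * (2 * 2⁻¹ ^ p.2) := by
      rintro ⟨j, r⟩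
      have h1 : coinMeasure (V j r) ≤ 2 * (2⁻¹ ^ r * 2⁻¹ ^ r) := by
        refine (ENNReal.toReal_le_toReal (measure_ne_top _ _) (by finiteness)).1 ?_
        refine (hVm j r).trans_eq ?_
        simp only [ENNReal.toReal_mul, ENNReal.toReal_pow, ENNReal.toReal_inv,
          ENNReal.toReal_ofNat, ← mul_pow]
        norm_num
      have h2 : (2 : ENNReal) ^ r * 2⁻¹ ^ r = 1 := by
        rw [← mul_pow, ENNReal.mul_inv_cancel (by simp) (by simp), one_pow]
      simp only [Measure.smul_apply, Measure.restrict_apply_univ, smul_eq_mul]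
      calc (2⁻¹ : ENNReal) ^ j * 2 ^ r * coinMeasure (V j r)
          ≤ 2⁻¹ ^ j * 2 ^ r * (2 * (2⁻¹ ^ r * 2⁻¹ ^ r)) := by gcongr
        _ = 2⁻¹ ^ j * (2 * ((2 ^ r * 2⁻¹ ^ r) * 2⁻¹ ^ r)) := by ring
        _ = 2⁻¹ ^ j * (2 * 2⁻¹ ^ r) := by rw [h2, one_mul]
    rw [Measure.sum_apply _ MeasurableSet.univ]
    refine ne_top_of_le_ne_top ?_ (ENNReal.tsum_le_tsum hle)
    rw [ENNReal.tsum_prod']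
    simp only [ENNReal.tsum_mul_left, ENNReal.tsum_mul_right, ENNReal.tsum_geometric]
    simp only [ENNReal.one_sub_inv_two, inv_inv]
    finiteness
  have : IsFiniteMeasure ν := ⟨lt_top_iff_ne_top.2 hν⟩
  let D : List Bool → ℝ := fun σ => 2 ^ σ.length * ν.real (cylinderOf σ)
  have hsub : ∀ σ b, cylinderOf (σ ++ [b]) ⊆ cylinderOf σ := by
    intro σ b A hA
    rw [mem_cylinderOf, List.length_append, List.length_singleton, initSeg_succ] at hA
    exact (List.append_inj hA (length_initSeg _ _)).1
  have hlen : ∀ σ b, D (σ ++ [b]) = 2 ^ σ.length * (2 * ν.real (cylinderOf (σ ++ [b]))) := by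
    intro σ b
    simp only [D, List.length_append, List.length_singleton, pow_succ]
    ring
  refine ⟨g, D, hg, hgm, fun σ => by positivity, fun σ => ?_, fun σ b => ?_, fun A hA => ?_⟩
  · have hdisj : Disjoint (cylinderOf (σ ++ [true])) (cylinderOf (σ ++ [false])) := by
      refine Set.disjoint_left.2 fun A h1 h2 => ?_
      rw [mem_cylinderOf] at h1 h2
      simp only [List.length_append, List.length_singleton] at h1 h2
      rw [h1] at h2
      simp at h2
    have hadd : ν.real (cylinderOf (σ ++ [true])) + ν.real (cylinderOf (σ ++ [false])) ≤
        ν.real (cylinderOf σ) := by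
      rw [← measureReal_union hdisj (isClopen_cylinderOf _).isOpen.measurableSet]
      exact measureReal_mono (Set.union_subset (hsub _ _) (hsub _ _))
    by_contra! hcon
    have h1 := hcon true
    have h2 := hcon false
    rw [hlen] at h1 h2
    have h1' := lt_of_mul_lt_mul_left h1 (by positivity)
    have h2' := lt_of_mul_lt_mul_left h2 (by positivity)
    linarith
  · rw [hlen]
    have : ν.real (cylinderOf (σ ++ [b])) ≤ ν.real (cylinderOf σ) := measureReal_mono (hsub σ b)
    simp only [D]
    nlinarith [pow_pos (show (0 : ℝ) < 2 by norm_num) σ.length]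
  · obtain ⟨j, hj⟩ := hVr A hA
    refine ⟨j, fun R => ?_⟩
    obtain ⟨r, hr, hAr⟩ := hj R
    refine ⟨r, hr, ?_⟩
    have h1 : (2⁻¹ : ENNReal) ^ j * 2 ^ r * 2⁻¹ ^ (g j r) ≤ ν (cylinderOf (initSeg A (g j r))) := by
      have h2 := Measure.le_sum (fun p : ℕ × ℕ =>
        ((2⁻¹ : ENNReal) ^ p.1 * 2 ^ p.2) • coinMeasure.restrict (V p.1 p.2)) (j, r)
        (cylinderOf (initSeg A (g j r)))
      rwa [Measure.smul_apply, Measure.restrict_apply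
        (isClopen_cylinderOf _).isOpen.measurableSet,
        Set.inter_eq_left.2 (hVc j r A hAr), coinMeasure_cylinderOf, length_initSeg,
        smul_eq_mul] at h2
    have h3 := ENNReal.toReal_mono (measure_ne_top _ _) h1
    simp only [ENNReal.toReal_mul, ENNReal.toReal_pow, ENNReal.toReal_inv,
      ENNReal.toReal_ofNat] at h3
    simp only [D, length_initSeg]
    calc (2 : ℝ) ^ r = 2 ^ j * (2 ^ (g j r) * (2⁻¹ ^ j * 2 ^ r * 2⁻¹ ^ (g j r))) := by
          rw [inv_pow, inv_pow]; field_simp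
      _ ≤ _ := by gcongr; exact h3

/-! ### Padding an open set to an exact measure -/

/-- The natural number with binary expansion `w`, most significant bit first. -/
def binVal (w : List Bool) : ℕ := w.foldl (fun a b => 2 * a + b.toNat) 0

theorem binVal_concat (w : List Bool) (b : Bool) :
    binVal (w ++ [b]) = 2 * binVal w + b.toNat := by
  simp [binVal]

theorem primrec_binVal : Primrec binVal := by
  have hb : Primrec Bool.toNat := Primrec.dom_finite _
  have hs := Primrec.snd (α := List Bool) (β := ℕ × Bool)
  have hstep : Primrec₂ fun (_ : List Bool) (q : ℕ × Bool) => 2 * q.1 + q.2.toNat :=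
    Primrec.nat_add.comp (Primrec.nat_mul.comp (Primrec.const 2) (Primrec.fst.comp hs))
      (hb.comp (Primrec.snd.comp hs))
  exact Primrec.list_foldl Primrec.id (Primrec.const 0) hstep

theorem binVal_initSeg_succ (A : CantorSpace) (n : ℕ) :
    binVal (initSeg A (n + 1)) = 2 * binVal (initSeg A n) + (A n).toNat := by
  rw [initSeg_succ, binVal_concat]

theorem binVal_initSeg_lt (A : CantorSpace) (n : ℕ) : binVal (initSeg A n) < 2 ^ n := by
  induction n with
  | zero => simp [initSeg, binVal]
  | succ n ih =>
    rw [binVal_initSeg_succ, pow_succ]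
    have := Bool.toNat_le (A n)
    omega

theorem binVal_initSeg_inj {A B : CantorSpace} {n : ℕ}
    (h : binVal (initSeg A n) = binVal (initSeg B n)) : initSeg A n = initSeg B n := by
  induction n with
  | zero => rfl
  | succ n ih =>
    rw [binVal_initSeg_succ, binVal_initSeg_succ] at h
    have h1 := Bool.toNat_le (A n)
    have h2 := Bool.toNat_le (B n)
    have h3 : (A n).toNat = (B n).toNat := by omega
    rw [initSeg_succ, initSeg_succ, ih (by omega)]
    congr 2
    revert h3
    cases A n <;> cases B n <;> simp

/-- The sequences whose first `n` bits, read as a number, are below `v`: the initial segment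
`[0, v / 2ⁿ)` of the unit interval. -/
def binBelow (n v : ℕ) : Set CantorSpace := {A | binVal (initSeg A n) < v}

theorem binBelow_mono (n : ℕ) : Monotone (binBelow n) := fun _ _ h _ hA => lt_of_lt_of_le hA h

theorem binBelow_zero (n : ℕ) : binBelow n 0 = ∅ := by
  simp [binBelow]

theorem binBelow_two_pow (n : ℕ) : binBelow n (2 ^ n) = Set.univ := by
  ext A
  simpa [binBelow] using binVal_initSeg_lt A n

theorem binBelow_succ_two_mul (n v : ℕ) : binBelow (n + 1) (2 * v) = binBelow n v := by
  ext A
  simp only [binBelow, Set.mem_ofPred_eq, binVal_initSeg_succ]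
  have := Bool.toNat_le (A n)
  omega

theorem coinMeasure_real_union_binBelow_succ_le (B : Set CantorSpace) (n v : ℕ) :
    coinMeasure.real (B ∪ binBelow n (v + 1)) ≤
      coinMeasure.real (B ∪ binBelow n v) + (1 / 2 : ℝ) ^ n := by
  have h : ∃ w : List Bool, w.length = n ∧ binBelow n (v + 1) ⊆ binBelow n v ∪ cylinderOf w := by
    by_cases hex : ∃ A, binVal (initSeg A n) = v
    · obtain ⟨A, hA⟩ := hex
      refine ⟨initSeg A n, length_initSeg A n, fun C hC => ?_⟩
      rcases (Nat.lt_succ_iff.1 hC).lt_or_eq with h | h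
      · exact Or.inl h
      · right
        rw [mem_cylinderOf, length_initSeg]
        exact binVal_initSeg_inj (h.trans hA.symm)
    · refine ⟨List.replicate n false, by simp, fun C hC => Or.inl ?_⟩
      exact (Nat.lt_succ_iff.1 hC).lt_of_ne fun h => hex ⟨C, h⟩
  obtain ⟨w, rfl, hw⟩ := h
  rw [← coinMeasure_real_cylinderOf]
  refine (measureReal_mono ?_).trans (measureReal_union_le _ _)
  rw [Set.union_assoc]
  exact Set.union_subset_union_right B hw

/-- The initial segments of the unit interval that can be added to `B` while keeping the measure
below `2⁻ⁱ`. -/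
def padding (B : Set CantorSpace) (i n : ℕ) : Set CantorSpace :=
  {A | coinMeasure.real (B ∪ binBelow n (binVal (initSeg A n) + 1)) < (1 / 2 : ℝ) ^ i}

theorem padding_mono (B : Set CantorSpace) (i : ℕ) : Monotone (padding B i) := by
  refine monotone_nat_of_le_succ fun n A hA => ?_
  refine lt_of_le_of_lt (measureReal_mono (Set.union_subset_union_right B ?_)) hA
  rw [← binBelow_succ_two_mul n, binVal_initSeg_succ]
  refine binBelow_mono _ ?_
  have := Bool.toNat_le (A n)
  omega

theorem real_union_padding_bounds {B : Set CantorSpace} {i : ℕ}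
    (hB : coinMeasure.real B ≤ (1 / 2 : ℝ) ^ i) (n : ℕ) :
    coinMeasure.real (B ∪ padding B i n) ≤ (1 / 2 : ℝ) ^ i ∧
      (1 / 2 : ℝ) ^ i ≤ coinMeasure.real (B ∪ padding B i n) + (1 / 2 : ℝ) ^ n := by
  classical
  have hex : ∃ v, (1 / 2 : ℝ) ^ i ≤ coinMeasure.real (B ∪ binBelow n v) := by
    refine ⟨2 ^ n, ?_⟩
    rw [binBelow_two_pow, Set.union_univ, probReal_univ]
    exact pow_le_one₀ (by norm_num) (by norm_num)
  -- The least `v` for which `B ∪ [0, v / 2ⁿ)` is too large; the padding is `[0, (v - 1) / 2ⁿ)`.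
  obtain ⟨v, hv, hmin⟩ : ∃ v, (1 / 2 : ℝ) ^ i ≤ coinMeasure.real (B ∪ binBelow n v) ∧
      ∀ u < v, coinMeasure.real (B ∪ binBelow n u) < (1 / 2 : ℝ) ^ i :=
    ⟨Nat.find hex, Nat.find_spec hex, fun u hu => not_le.1 (Nat.find_min hex hu)⟩
  have hpad : padding B i n = binBelow n (v - 1) := by
    ext A
    constructor
    · intro hA
      by_contra hcon
      refine absurd (hv.trans (measureReal_mono (Set.union_subset_union_right B
        (binBelow_mono n ?_)))) (not_le.2 hA)
      have : v - 1 ≤ binVal (initSeg A n) := not_lt.1 hcon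
      omega
    · intro hA
      have : binVal (initSeg A n) < v - 1 := hA
      exact hmin _ (by omega)
  rw [hpad]
  cases v with
  | zero =>
    rw [Nat.zero_sub]
    refine ⟨by rwa [binBelow_zero, Set.union_empty], hv.trans ?_⟩
    linarith [pow_pos (show (0 : ℝ) < 1 / 2 by norm_num) n]
  | succ u =>
    rw [Nat.add_sub_cancel]
    exact ⟨(hmin u (Nat.lt_succ_self u)).le,
      hv.trans (coinMeasure_real_union_binBelow_succ_le B n u)⟩

theorem measure_union_iUnion_padding {B : Set CantorSpace} {i : ℕ}
    (hB : coinMeasure.real B ≤ (1 / 2 : ℝ) ^ i) :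
    coinMeasure (B ∪ ⋃ n, padding B i n) = (2⁻¹ : ENNReal) ^ i := by
  rw [measure_eq_two_inv_pow_iff]
  have hmono : Monotone fun n => B ∪ padding B i n := fun m n h =>
    Set.union_subset_union_right B (padding_mono B i h)
  have hlim : Filter.Tendsto (fun n => coinMeasure.real (B ∪ padding B i n)) Filter.atTop
      (nhds (coinMeasure.real (B ∪ ⋃ n, padding B i n))) := by
    have h := tendsto_measure_iUnion_atTop (μ := coinMeasure) hmono
    rw [← Set.union_iUnion] at h
    exact (ENNReal.tendsto_toReal (measure_ne_top _ _)).comp h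
  refine le_antisymm (le_of_tendsto' hlim fun n => (real_union_padding_bounds hB n).1) ?_
  have h0 := hlim.add
    (tendsto_pow_atTop_nhds_zero_of_lt_one (r := (1 / 2 : ℝ)) (by norm_num) (by norm_num))
  rw [add_zero] at h0
  exact ge_of_tendsto' h0 fun n => (real_union_padding_bounds hB n).2

/-! ### Long blocks of zeros at computable places -/

/-- The sequences with `m` zeros from place `p` on. -/
def zeroWindow (p m : ℕ) : Set CantorSpace := {A | ∀ j < m, A (p + j) = false}

theorem coinMeasure_zeroWindow (p m : ℕ) : coinMeasure (zeroWindow p m) = (2⁻¹ : ENNReal) ^ m := by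
  have h := coinMeasure_agree (Finset.Ico p (p + m)) (fun _ => false)
  rw [Nat.card_Ico, Nat.add_sub_cancel_left] at h
  rw [← h]
  congr 1
  ext A
  simp only [zeroWindow, Set.mem_ofPred_eq, Finset.mem_Ico]
  constructor
  · rintro h i ⟨h1, h2⟩
    obtain ⟨j, rfl⟩ := Nat.exists_eq_add_of_le h1
    exact h j (by omega)
  · exact fun h j hj => h _ ⟨by omega, by omega⟩

/-- The sequences with a block of `m` zeros at place `n m` for some `m > i`. -/
def windowTail (n : ℕ → ℕ) (i : ℕ) : Set CantorSpace := ⋃ m, ⋃ (_ : i < m), zeroWindow (n m) m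

theorem coinMeasure_real_windowTail_le (n : ℕ → ℕ) (i : ℕ) :
    coinMeasure.real (windowTail n i) ≤ (1 / 2 : ℝ) ^ i := by
  have h : windowTail n i ⊆ ⋃ m, zeroWindow (n (i + 1 + m)) (i + 1 + m) := by
    intro A hA
    simp only [windowTail, Set.mem_iUnion] at hA ⊢
    obtain ⟨m, hm, hA⟩ := hA
    obtain ⟨k, rfl⟩ := Nat.exists_eq_add_of_le (Nat.succ_le_of_lt hm)
    exact ⟨k, hA⟩
  have h1 : coinMeasure (windowTail n i) ≤ (2⁻¹ : ENNReal) ^ i := by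
    refine (measure_mono h).trans ((measure_iUnion_le _).trans_eq ?_)
    simp only [coinMeasure_zeroWindow]
    simp only [pow_add _ (i + 1), ENNReal.tsum_mul_left, ENNReal.tsum_geometric,
      ENNReal.one_sub_inv_two, inv_inv]
    rw [pow_succ, mul_assoc, ENNReal.inv_mul_cancel (by simp) (by simp), mul_one]
  refine (ENNReal.toReal_mono (by finiteness) h1).trans_eq ?_
  simp

/-- The finite part of `windowTail n i` with `i < m ≤ M`. -/
def windowPart (n : ℕ → ℕ) (i M : ℕ) : Set CantorSpace :=
  {A | ∃ m < M + 1, i < m ∧ A ∈ zeroWindow (n m) m}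

theorem windowPart_subset (n : ℕ → ℕ) (i M : ℕ) : windowPart n i M ⊆ windowTail n i := by
  rintro A ⟨m, -, hm, hA⟩
  exact Set.mem_iUnion₂.2 ⟨m, hm, hA⟩

theorem windowTail_subset (n : ℕ → ℕ) (i M : ℕ) :
    windowTail n i ⊆ windowPart n i M ∪ windowTail n M := by
  intro A hA
  obtain ⟨m, hm, hA⟩ := Set.mem_iUnion₂.1 hA
  by_cases h : m < M + 1
  · exact Or.inl ⟨m, h, hm, hA⟩
  · exact Or.inr (Set.mem_iUnion₂.2 ⟨m, by omega, hA⟩)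

theorem real_windowTail_union_lt_iff (n : ℕ → ℕ) (i : ℕ) (S : Set CantorSpace) (x : ℝ) :
    coinMeasure.real (windowTail n i ∪ S) < x ↔
      ∃ M, coinMeasure.real (windowPart n i M ∪ S) + (1 / 2 : ℝ) ^ M < x := by
  constructor
  · intro h
    obtain ⟨M, hM⟩ := exists_pow_lt_of_lt_one (sub_pos.2 h) (show (1 / 2 : ℝ) < 1 by norm_num)
    have := measureReal_mono (μ := coinMeasure)
      (Set.union_subset_union_left S (windowPart_subset n i M))
    exact ⟨M, by linarith⟩
  · rintro ⟨M, hM⟩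
    have h1 : windowTail n i ∪ S ⊆ (windowPart n i M ∪ S) ∪ windowTail n M := by
      rintro A (hA | hA)
      · rcases windowTail_subset n i M hA with h | h
        · exact Or.inl (Or.inl h)
        · exact Or.inr h
      · exact Or.inl (Or.inr hA)
    have h2 := (measureReal_mono (μ := coinMeasure) h1).trans (measureReal_union_le _ _)
    have h3 := coinMeasure_real_windowTail_le n M
    linarith

/-- The string `σ` has a block of `m` zeros at place `l[m]`, for some `m > i`. -/
def WindowHit (l : List ℕ) (i : ℕ) (σ : List Bool) : Prop :=
  ∃ m ∈ List.range l.length, i < m ∧ ∀ j ∈ List.range m, σ[l.getD m 0 + j]? = some false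

theorem windowHit_map_range {n : ℕ → ℕ} {i M : ℕ} {σ : List Bool} :
    WindowHit ((List.range (M + 1)).map n) i σ ↔
      ∃ m < M + 1, i < m ∧ ∀ j < m, σ[n m + j]? = some false := by
  simp only [WindowHit, List.length_map, List.length_range, List.mem_range]
  refine exists_congr fun m => and_congr_right fun hm => and_congr_right fun _ => ?_
  have : ((List.range (M + 1)).map n).getD m 0 = n m := by
    simp [List.getD_eq_getElem?_getD, hm]
  rw [this]

theorem windowHit_initSeg {n : ℕ → ℕ} (hn : Monotone n) {i M N : ℕ} (hN : n M + M ≤ N)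
    {A : CantorSpace} :
    WindowHit ((List.range (M + 1)).map n) i (initSeg A N) ↔ A ∈ windowPart n i M := by
  rw [windowHit_map_range]
  refine exists_congr fun m => and_congr_right fun hm => and_congr_right fun _ =>
    forall₂_congr fun j hj => ?_
  have := hn (Nat.lt_succ_iff.1 hm)
  rw [getElem?_initSeg (by omega), Option.some_inj]

theorem primrecPred_windowHit :
    PrimrecPred fun q : (List ℕ × ℕ) × List Bool => WindowHit q.1.1 q.1.2 q.2 := by
  have hJ : PrimrecRel fun (j : ℕ) (q : ℕ × (List ℕ × ℕ) × List Bool) =>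
      q.2.2[q.2.1.1.getD q.1 0 + j]? = some false := by
    have hq := Primrec.snd (α := ℕ) (β := ℕ × (List ℕ × ℕ) × List Bool)
    have hl := Primrec.fst.comp (Primrec.fst.comp (Primrec.snd.comp hq))
    have hσ := Primrec.snd.comp (Primrec.snd.comp hq)
    have hm := Primrec.fst.comp hq
    exact Primrec.eq.comp (Primrec.list_getElem?.comp hσ
      (Primrec.nat_add.comp ((Primrec.list_getD 0).comp hl hm) Primrec.fst)) (Primrec.const _)
  have hM : PrimrecRel fun (m : ℕ) (q : (List ℕ × ℕ) × List Bool) =>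
      q.1.2 < m ∧ ∀ j ∈ List.range m, q.2[q.1.1.getD m 0 + j]? = some false := by
    have hq := Primrec.snd (α := ℕ) (β := (List ℕ × ℕ) × List Bool)
    refine PrimrecPred.and ?_ ?_
    · exact Primrec.nat_lt.comp (Primrec.snd.comp (Primrec.fst.comp hq)) Primrec.fst
    · exact hJ.forall_mem_list.comp (Primrec.list_range.comp Primrec.fst) Primrec.id
  exact hM.exists_mem_list.comp (Primrec.list_range.comp (Primrec.list_length.comp
    (Primrec.fst.comp Primrec.fst))) Primrec.id

/-- The strings in the set obtained from the windows listed in `l` by adding everything that is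
at most `w`. -/
def PadHit (l : List ℕ) (i : ℕ) (w σ : List Bool) : Prop :=
  WindowHit l i σ ∨ binVal (σ.take w.length) ≤ binVal w

/-- The string `w` can be used for padding, as seen from the windows `m ≤ M`, which are listed in
`l` and lie below `K`. The term `2 ^ N`, where `N` is the level at which strings are counted,
accounts for the later windows. -/
def PadGood (l : List ℕ) (M K i : ℕ) (w : List Bool) : Prop :=
  (levelCount (PadHit l i w) (K + w.length) * 2 ^ M + 2 ^ (K + w.length)) * 2 ^ i <
    2 ^ (K + w.length + M)

theorem padGood_iff {n : ℕ → ℕ} (hn : Monotone n) {i M : ℕ} {w : List Bool} :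
    PadGood ((List.range (M + 1)).map n) M (n M + M) i w ↔
      coinMeasure.real (windowPart n i M ∪ binBelow w.length (binVal w + 1)) + (1 / 2 : ℝ) ^ M <
        (1 / 2 : ℝ) ^ i := by
  have h : windowPart n i M ∪ binBelow w.length (binVal w + 1) =
      {A | PadHit ((List.range (M + 1)).map n) i w (initSeg A (n M + M + w.length))} := by
    ext A
    simp only [PadHit, Set.mem_union, Set.mem_ofPred_eq,
      windowHit_initSeg hn (Nat.le_add_right _ _), take_initSeg A (Nat.le_add_left _ _),
      binBelow, Nat.lt_succ_iff]
  rw [h, coinMeasure_real_level, PadGood, ← @Nat.cast_lt ℝ]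
  generalize levelCount _ _ = C
  generalize n M + M + w.length = N
  push_cast
  rw [← mul_lt_mul_iff_right₀ (b := (C : ℝ) / 2 ^ N + (1 / 2) ^ M)
    (show (0 : ℝ) < 2 ^ (N + M + i) by positivity)]
  have h1 : (2 : ℝ) ^ (N + M + i) * (1 / 2) ^ i = 2 ^ (N + M) := by
    rw [one_div, inv_pow]; field_simp; ring
  have h2 : (2 : ℝ) ^ (N + M + i) * (C / 2 ^ N + (1 / 2) ^ M) =
      (C * 2 ^ M + 2 ^ N) * 2 ^ i := by
    rw [one_div, inv_pow]; field_simp; ring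
  rw [h1, h2]

theorem primrecPred_padGood :
    PrimrecPred fun q : (List ℕ × ℕ × ℕ) × ℕ × List Bool =>
      PadGood q.1.1 q.1.2.1 q.1.2.2 q.2.1 q.2.2 := by
  have hR : PrimrecRel fun (σ : List Bool) (q : (List ℕ × ℕ × ℕ) × ℕ × List Bool) =>
      PadHit q.1.1 q.2.1 q.2.2 σ := by
    have hσ := Primrec.fst (α := List Bool) (β := (List ℕ × ℕ × ℕ) × ℕ × List Bool)
    have hq := Primrec.snd (α := List Bool) (β := (List ℕ × ℕ × ℕ) × ℕ × List Bool)
    have hl := Primrec.fst.comp (Primrec.fst.comp hq)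
    have hi := Primrec.fst.comp (Primrec.snd.comp hq)
    have hw := Primrec.snd.comp (Primrec.snd.comp hq)
    exact PrimrecPred.or (primrecPred_windowHit.comp (Primrec.pair (Primrec.pair hl hi) hσ))
      (Primrec.nat_le.comp (primrec_binVal.comp
        (Primrec.list_take.comp (Primrec.list_length.comp hw) hσ)) (primrec_binVal.comp hw))
  have h1 := Primrec.fst (α := List ℕ × ℕ × ℕ) (β := ℕ × List Bool)
  have h2 := Primrec.snd (α := List ℕ × ℕ × ℕ) (β := ℕ × List Bool)
  have hM := Primrec.fst.comp (Primrec.snd.comp h1)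
  have hK := Primrec.snd.comp (Primrec.snd.comp h1)
  have hi := Primrec.fst.comp h2
  have hN := Primrec.nat_add.comp hK (Primrec.list_length.comp (Primrec.snd.comp h2))
  have hC := (primrec_levelCount hR).comp (Primrec.pair Primrec.id hN)
  exact Primrec.nat_lt.comp (Primrec.nat_mul.comp (Primrec.nat_add.comp
    (Primrec.nat_mul.comp hC (Primrec.nat_pow_two hM)) (Primrec.nat_pow_two hN))
      (Primrec.nat_pow_two hi)) (Primrec.nat_pow_two (Primrec.nat_add.comp hN hM))

theorem Computable.map_range {n : ℕ → ℕ} (hn : Computable n) :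
    Computable fun M => (List.range M).map n := by
  refine (Computable.nat_rec (f := fun M : ℕ => M) (g := fun _ => ([] : List ℕ))
    (h := fun _ p => p.2 ++ [n p.1]) Computable.id (Computable.const _) ?_).of_eq fun M => ?_
  · have h1 : Computable fun q : ℕ × ℕ × List ℕ => q.2.1 := Computable.fst.comp Computable.snd
    have h2 : Computable fun q : ℕ × ℕ × List ℕ => q.2.2 := Computable.snd.comp Computable.snd
    exact Computable.list_concat.comp h2 (hn.comp h1)
  · induction M with
    | zero => rfl
    | succ M ih => simp only at ih ⊢; rw [ih, List.range_succ, List.map_append]; rfl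

theorem ComputablePred.exists_re {α : Type*} [Primcodable α] {p : α × ℕ → Prop}
    (hp : ComputablePred p) : REPred fun a => ∃ n, p (a, n) := by
  classical
  obtain ⟨hd, hp⟩ := hp
  have hp' : Partrec₂ fun (a : α) (n : ℕ) => (Part.some (decide (p (a, n))) : Part Bool) :=
    hp.partrec
  refine (Partrec.rfind hp').dom_re.of_eq fun a => ?_
  refine Nat.rfind_dom'.trans ?_
  simp only [Part.mem_some_iff, Part.some_dom, implies_true, and_true, eq_comm (a := true),
    decide_eq_true_eq]

theorem PrimrecPred.computablePred_comp {α β : Type*} [Primcodable α] [Primcodable β]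
    {p : β → Prop} (hp : PrimrecPred p) {f : α → β} (hf : Computable f) :
    ComputablePred fun a => p (f a) := by
  obtain ⟨hd, hp⟩ := hp
  exact ⟨fun a => hd (f a), hp.to_comp.comp hf⟩

/-- Sequences with infinitely many of the blocks of zeros at computable places are not Schnorr
random. The open sets `windowTail n i` form a test except that their measures are only bounded by
`2⁻ⁱ`; they are padded by initial segments of the unit interval. That a segment may be used is a
`Σ₁` condition because the measure of `windowTail n i` is computable. -/
theorem notMem_randSchnorr_of_windows {n : ℕ → ℕ} (hn : Computable n) (hmono : Monotone n)
    {A : CantorSpace} (hA : ∀ R, ∃ m > R, A ∈ zeroWindow (n m) m) : A ∉ RandSchnorr := by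
  let U : ℕ → Set CantorSpace := fun i => windowTail n i ∪ ⋃ k, padding (windowTail n i) i k
  have hAU : ∀ i, A ∈ U i := by
    intro i
    obtain ⟨m, hm, h⟩ := hA i
    exact Or.inl (Set.mem_iUnion₂.2 ⟨m, hm, h⟩)
  suffices h : IsSchnorrTest U by
    simp only [RandSchnorr, SchnorrNull, Set.mem_ofPred_eq, not_not, Set.singleton_subset_iff,
      Set.mem_iInter]
    exact ⟨U, h, hAU⟩
  refine ⟨?_, fun i => measure_union_iUnion_padding (coinMeasure_real_windowTail_le n i)⟩
  let L : ℕ → List ℕ := fun M => (List.range (M + 1)).map n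
  have hL : Computable L := hn.map_range.comp Computable.succ
  refine ⟨fun a => ∃ M, WindowHit (L M) a.1 a.2 ∨ PadGood (L M) M (n M + M) a.1 a.2, ?_,
    fun i => ?_⟩
  · have hp : PrimrecPred fun q : (List ℕ × ℕ × ℕ) × ℕ × List Bool =>
        WindowHit q.1.1 q.2.1 q.2.2 ∨ PadGood q.1.1 q.1.2.1 q.1.2.2 q.2.1 q.2.2 := by
      refine PrimrecPred.or (primrecPred_windowHit.comp (Primrec.pair (Primrec.pair
        (Primrec.fst.comp Primrec.fst) (Primrec.fst.comp Primrec.snd))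
        (Primrec.snd.comp Primrec.snd))) primrecPred_padGood
    have hM := Computable.snd (α := ℕ × List Bool) (β := ℕ)
    exact (hp.computablePred_comp (Computable.pair (Computable.pair (hL.comp hM)
      (Computable.pair hM (Primrec.nat_add.to_comp.comp (hn.comp hM) hM)))
      Computable.fst)).exists_re
  · ext C
    simp only [U, Set.mem_union, Set.mem_iUnion, Set.mem_ofPred_eq]
    constructor
    · rintro (h | ⟨k, h⟩)
      · obtain ⟨m, hm, h⟩ := Set.mem_iUnion₂.1 h
        refine ⟨initSeg C (n m + m), ⟨m, Or.inl ((windowHit_initSeg hmono le_rfl).2 ?_)⟩, ?_⟩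
        · exact ⟨m, Nat.lt_succ_self m, hm, h⟩
        · rw [mem_cylinderOf, length_initSeg]
      · obtain ⟨M, hM⟩ := (real_windowTail_union_lt_iff n i _ _).1 h
        refine ⟨initSeg C k, ⟨M, Or.inr ((padGood_iff hmono).2 ?_)⟩, ?_⟩
        · rwa [length_initSeg]
        · rw [mem_cylinderOf, length_initSeg]
    · rintro ⟨w, ⟨M, h | h⟩, hw⟩
      · left
        obtain ⟨m, hm, him, h⟩ := windowHit_map_range.1 h
        refine Set.mem_iUnion₂.2 ⟨m, him, fun j hj => ?_⟩
        have h1 := h j hj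
        have h2 : n m + j < w.length := by
          by_contra hcon
          rw [List.getElem?_eq_none (not_lt.1 hcon)] at h1
          simp at h1
        rw [mem_cylinderOf] at hw
        rw [← hw, getElem?_initSeg h2] at h1
        exact Option.some_inj.1 h1
      · right
        refine ⟨w.length, (real_windowTail_union_lt_iff n i _ _).2 ⟨M, ?_⟩⟩
        rw [mem_cylinderOf] at hw
        rw [hw]
        exact (padGood_iff hmono).1 h

/-! ### Coding infinitely many events into a sequence -/

/-- A computable choice of places `n m` for the blocks of strategy `k`: test `j` sets its targets up
to the `2m`-th at lengths below `n m`. -/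
theorem exists_dominating {g : ℕ → ℕ → ℕ} (hg : ∀ j, Computable (g j)) (k : ℕ) :
    ∃ n : ℕ → ℕ, Computable n ∧ StrictMono n ∧ ∀ j < k, ∀ m, g j (2 * m) < n m := by
  have h : ∃ F : ℕ → ℕ, Computable F ∧ ∀ j < k, ∀ m, g j (2 * m) ≤ F m := by
    induction k with
    | zero => exact ⟨fun _ => 0, Computable.const 0, fun j hj => absurd hj (Nat.not_lt_zero j)⟩
    | succ k ih =>
      obtain ⟨F, hF, hFg⟩ := ih
      refine ⟨fun m => F m + g k (2 * m), Primrec.nat_add.to_comp.comp hF ((hg k).comp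
        (Primrec.nat_mul.to_comp.comp (Computable.const 2) Computable.id)), fun j hj m => ?_⟩
      rcases Nat.lt_succ_iff_lt_or_eq.1 hj with h | rfl
      · exact (hFg j h m).trans (Nat.le_add_right _ _)
      · exact Nat.le_add_left _ _
  obtain ⟨F, hF, hFg⟩ := h
  obtain ⟨n, hn, hm, hFn⟩ := (Computable.succ.comp hF).exists_strictMono_ge
  exact ⟨n, hn, hm, fun j hj m => (Nat.lt_succ_of_le (hFg j hj m)).trans_le (hFn m)⟩

/-- The capital at `σ` is below every target `2 ^ (r - j)` with `r ≥ R` that the `j`-th test sets at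
a length `g j r` not less than the length of `σ`. -/
def Safe (g : ℕ → ℕ → ℕ) (D : List Bool → ℝ) (j R : ℕ) (σ : List Bool) : Prop :=
  ∀ r ≥ R, σ.length ≤ g j r → 2 ^ j * D σ < 2 ^ r

theorem Safe.of_le {g : ℕ → ℕ → ℕ} {D : List Bool → ℝ} {j R : ℕ} {σ τ : List Bool}
    (h : Safe g D j R σ) (hl : σ.length ≤ τ.length) (hD : D τ ≤ D σ) : Safe g D j R τ := by
  intro r hr hrτ
  refine lt_of_le_of_lt ?_ (h r hr (hl.trans hrτ))
  gcongr

theorem exists_coast {D : List Bool → ℝ} (hD : ∀ σ, ∃ b, D (σ ++ [b]) ≤ D σ) (σ : List Bool)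
    (d : ℕ) : ∃ τ : List Bool, τ.length = d ∧ ∀ ρ, ρ <+: τ → D (σ ++ ρ) ≤ D σ := by
  induction d with
  | zero =>
    refine ⟨[], rfl, fun ρ hρ => ?_⟩
    rw [List.prefix_nil.1 hρ, List.append_nil]
  | succ d ih =>
    obtain ⟨τ, hτ, h⟩ := ih
    obtain ⟨b, hb⟩ := hD (σ ++ τ)
    refine ⟨τ ++ [b], by simp [hτ], fun ρ hρ => ?_⟩
    rcases List.prefix_concat_iff.1 hρ with rfl | hρ
    · rw [← List.append_assoc]
      exact hb.trans (h τ (List.prefix_refl τ))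
    · exact h ρ hρ

theorem capital_append_le {D : List Bool → ℝ} (hD : ∀ σ b, D (σ ++ [b]) ≤ 2 * D σ)
    (σ τ : List Bool) : D (σ ++ τ) ≤ 2 ^ τ.length * D σ := by
  induction τ using List.reverseRecOn with
  | nil => simp
  | append_singleton τ b ih =>
    rw [← List.append_assoc, List.length_append, List.length_singleton, pow_succ]
    linarith [hD (σ ++ τ) b]

/-- One action of strategy `k`: after coasting to the place `n m`, put a block of `m` zeros, where
`m` is large compared with the current capital. The block multiplies the capital by at most `2ᵐ`,
while a test `j < k` that is due at length `n m` or later asks for more than `2 ^ (2m - j)`. -/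
theorem exists_action {g : ℕ → ℕ → ℕ} {D : List Bool → ℝ} (hgm : ∀ j, StrictMono (g j))
    (h0 : ∀ σ, 0 ≤ D σ) (h1 : ∀ σ, ∃ b, D (σ ++ [b]) ≤ D σ) (h2 : ∀ σ b, D (σ ++ [b]) ≤ 2 * D σ)
    {k : ℕ} {n : ℕ → ℕ} (hnm : StrictMono n) (hn : ∀ j < k, ∀ m, g j (2 * m) < n m)
    (σ : List Bool) :
    ∃ τ, σ <+: τ ∧ σ.length < τ.length ∧
      (∃ m > σ.length, ∀ i < m, τ[n m + i]? = some false) ∧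
      ∀ j < k, ∀ R, Safe g D j R σ → ∀ ρ, σ <+: ρ → ρ <+: τ → Safe g D j R ρ := by
  obtain ⟨a, ha⟩ := pow_unbounded_of_one_lt (2 ^ k * D σ) (show (1 : ℝ) < 2 by norm_num)
  obtain ⟨m, hm, hma⟩ : ∃ m > σ.length, a ≤ m :=
    ⟨max a (σ.length + 1), Nat.lt_of_succ_le (le_max_right _ _), le_max_left _ _⟩
  have hmn : m ≤ n m := hnm.id_le m
  obtain ⟨τ, hτ, hcoast⟩ := exists_coast h1 σ (n m - σ.length)
  have hlen : (σ ++ τ).length = n m := by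
    rw [List.length_append, hτ]; omega
  refine ⟨(σ ++ τ) ++ List.replicate m false, (List.prefix_append _ _).trans
    (List.prefix_append _ _), ?_, ⟨m, hm, fun i hi => ?_⟩, fun j hj R hσ ρ hσρ hρ => ?_⟩
  · rw [List.length_append, hlen]; omega
  · rw [List.getElem?_append_right (by omega), hlen, Nat.add_sub_cancel_left,
      List.getElem?_replicate_of_lt hi]
  · have hpre : σ ++ τ <+: (σ ++ τ) ++ List.replicate m false := List.prefix_append _ _
    rcases List.prefix_or_prefix_of_prefix hρ hpre with h | h
    · obtain ⟨ρ', rfl⟩ := hσρ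
      exact hσ.of_le (by simp) (hcoast ρ' ((List.prefix_append_right_inj σ).1 h))
    · obtain ⟨ρ', rfl⟩ := h
      intro r hr hrρ
      have hρ' : ρ'.length ≤ m := by
        have := hρ.length_le
        simp only [List.length_append, List.length_replicate] at this
        omega
      have hr2 : 2 * m < r := by
        refine (hgm j).lt_iff_lt.1 ((hn j hj m).trans_le ?_)
        rw [List.length_append, hlen] at hrρ
        omega
      have hD : D (σ ++ τ) ≤ D σ := hcoast τ (List.prefix_refl τ)
      have hσ0 := h0 σ
      calc 2 ^ j * D (σ ++ τ ++ ρ') ≤ 2 ^ j * (2 ^ ρ'.length * D (σ ++ τ)) := by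
            gcongr; exact capital_append_le h2 _ _
        _ ≤ 2 ^ k * (2 ^ m * D σ) := by
            gcongr
            all_goals first | exact h0 _ | exact mul_nonneg (by positivity) (h0 _) | norm_num
        _ = 2 ^ m * (2 ^ k * D σ) := by ring
        _ < 2 ^ m * 2 ^ m := by
            gcongr
            exact ha.trans_le (pow_le_pow_right₀ (by norm_num) hma)
        _ = 2 ^ (2 * m) := by ring
        _ ≤ 2 ^ r := pow_le_pow_right₀ (by norm_num) hr2.le

section Limit

variable (step : Prop → ℕ → List Bool → List Bool)

/-- The strings built from a sequence of yes-no decisions `e`: stage `s` replaces the current string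
`σ` by `step (e s) s σ`. -/
def stageString (e : ℕ → Prop) : ℕ → List Bool
  | 0 => []
  | s + 1 => step (e s) s (stageString e s)

/-- The sequence extending all `stageString step e s`, if each step properly extends the string; the
default bit is then never used. -/
def limitSeq (e : ℕ → Prop) : CantorSpace := fun i => (stageString step e (i + 1)).getD i false

variable {step}

theorem stageString_prefix (hpre : ∀ q s σ, σ <+: step q s σ) (e : ℕ → Prop) {s t : ℕ}
    (h : s ≤ t) : stageString step e s <+: stageString step e t := by
  induction t, h using Nat.le_induction with
  | base => exact List.prefix_refl _
  | succ t _ ih => exact ih.trans (hpre _ _ _)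

theorem le_length_stageString (hlen : ∀ q s σ, σ.length < (step q s σ).length) (e : ℕ → Prop)
    (s : ℕ) : s ≤ (stageString step e s).length := by
  induction s with
  | zero => exact Nat.zero_le _
  | succ s ih => exact lt_of_le_of_lt ih (hlen _ _ _)

theorem initSeg_limitSeq (hpre : ∀ q s σ, σ <+: step q s σ)
    (hlen : ∀ q s σ, σ.length < (step q s σ).length) (e : ℕ → Prop) (s : ℕ) :
    initSeg (limitSeq step e) (stageString step e s).length = stageString step e s := by
  refine initSeg_eq_iff.2 ⟨rfl, fun i hi => ?_⟩
  have hi' : i < (stageString step e (i + 1)).length := le_length_stageString hlen e (i + 1)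
  simp only [limitSeq, List.getD_eq_getElem?_getD, List.getElem?_eq_getElem hi',
    List.getElem?_eq_getElem hi, Option.getD_some, Option.some_inj]
  rcases le_total s (i + 1) with h | h
  · exact (stageString_prefix hpre e h).getElem hi
  · exact ((stageString_prefix hpre e h).getElem hi').symm

theorem continuous_limitSeq {E : ℕ → Set CantorSpace} (hE : ∀ s, IsClopen (E s)) :
    Continuous fun X => limitSeq step fun s => X ∈ E s := by
  have h : ∀ s, IsLocallyConstant fun X => stageString step (fun s => X ∈ E s) s := by
    intro s
    induction s with
    | zero => exact IsLocallyConstant.const []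
    | succ s ih =>
      rw [IsLocallyConstant.iff_eventually_eq] at ih ⊢
      intro X
      have hX : ∀ᶠ Y in nhds X, (Y ∈ E s) = (X ∈ E s) := by
        by_cases hXE : X ∈ E s
        · filter_upwards [(hE s).isOpen.mem_nhds hXE] with Y hY
          simp [hXE, hY]
        · filter_upwards [(hE s).compl.isOpen.mem_nhds hXE] with Y hY
          have : Y ∉ E s := hY
          simp [hXE, this]
      filter_upwards [hX, ih X] with Y hY hY'
      simp only [stageString]
      rw [hY, hY']
  exact continuous_pi fun i => ((h (i + 1)).comp fun w => w.getD i false).continuous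

end Limit

/-- The reduction. Stage `s = ⟨k, p⟩` acts for strategy `k` if the `p`-th event for `k` occurs. A
strategy that acts infinitely often produces blocks of zeros at computable places. If each
strategy acts only finitely often, then after some stage only strategies `k > j` act, and these
keep the sequence safe from the `j`-th test. -/
theorem exists_reduction_of_events {E : ℕ → ℕ → Set CantorSpace} (hE : ∀ k p, IsClopen (E k p)) :
    ∃ f : CantorSpace → CantorSpace, Continuous f ∧
      ∀ X, (∃ k, {p | X ∈ E k p}.Infinite) ↔ f X ∉ RandSchnorr := by
  classical
  obtain ⟨g, D, hg, hgm, h0, h1, h2, hsucc⟩ := exists_capital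
  choose n hnc hnm hn using exists_dominating hg
  choose act hpre hlen hwin hsafe using fun k => exists_action hgm h0 h1 h2 (hnm k) (hn k)
  choose b hb using h1
  let step : Prop → ℕ → List Bool → List Bool := fun q s σ =>
    if q then act s.unpair.1 σ else σ ++ [b σ]
  have hpre' : ∀ q s σ, σ <+: step q s σ := by
    intro q s σ
    by_cases hq : q
    · simpa [step, hq] using hpre _ σ
    · simp [step, hq]
  have hlen' : ∀ q s σ, σ.length < (step q s σ).length := by
    intro q s σ
    by_cases hq : q
    · simpa [step, hq] using hlen _ σ
    · simp [step, hq]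
  have hsafe' : ∀ q s σ j R, (q → j < s.unpair.1) → Safe g D j R σ → ∀ ρ, σ <+: ρ →
      ρ <+: step q s σ → Safe g D j R ρ := by
    intro q s σ j R hqj hσ ρ hσρ hρ
    by_cases hq : q
    · simp only [step, hq, if_true] at hρ
      exact hsafe _ σ j (hqj hq) R hσ ρ hσρ hρ
    · simp only [step, hq, if_false] at hρ
      rcases List.prefix_concat_iff.1 hρ with rfl | hρ
      · exact hσ.of_le (by simp) (hb σ)
      · rwa [List.IsPrefix.eq_of_length_le hρ hσρ.length_le]
  let e : CantorSpace → ℕ → Prop := fun X s => X ∈ E s.unpair.1 s.unpair.2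
  refine ⟨fun X => limitSeq step (e X), continuous_limitSeq fun s => hE _ _, fun X => ?_⟩
  have hlim := initSeg_limitSeq hpre' hlen' (e X)
  have hlenS := le_length_stageString hlen' (e X)
  constructor
  · rintro ⟨k, hk⟩
    refine notMem_randSchnorr_of_windows (hnc k) (hnm k).monotone fun R => ?_
    obtain ⟨p, hp, hRp⟩ := hk.exists_gt R
    have hps : p ≤ Nat.pair k p := Nat.right_le_pair k p
    obtain ⟨m, hm, hz⟩ := hwin k (stageString step (e X) (Nat.pair k p))
    refine ⟨m, by have := hlenS (Nat.pair k p); omega, fun j hj => ?_⟩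
    have hact : stageString step (e X) (Nat.pair k p + 1) =
        act k (stageString step (e X) (Nat.pair k p)) := by
      have : e X (Nat.pair k p) := by simpa [e] using hp
      simp only [stageString, step, this, if_true, Nat.unpair_pair]
    have h3 := hz j hj
    rw [← hact, ← hlim] at h3
    have h4 : n k m + j < (stageString step (e X) (Nat.pair k p + 1)).length := by
      by_contra hcon
      rw [List.getElem?_eq_none (by rw [length_initSeg]; omega)] at h3
      simp at h3
    rw [getElem?_initSeg h4] at h3
    exact Option.some_inj.1 h3
  · intro hZ
    by_contra! hfin
    obtain ⟨j, hj⟩ := hsucc _ hZ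
    have hfin' : {s | s.unpair.1 ≤ j ∧ e X s}.Finite := by
      have : {s | s.unpair.1 ≤ j ∧ e X s} ⊆
          ⋃ k ∈ Finset.range (j + 1), Nat.pair k '' {p | X ∈ E k p} := by
        rintro s ⟨hs, hes⟩
        refine Set.mem_iUnion₂.2 ⟨s.unpair.1, Finset.mem_range.2 (Nat.lt_succ_of_le hs),
          s.unpair.2, hes, Nat.pair_unpair s⟩
      refine Set.Finite.subset (Set.Finite.biUnion (Finset.finite_toSet _) fun k _ => ?_) this
      exact (hfin k).image _
    -- After stage `s₀` only strategies `k > j` act, and no target from the `R₀`-th on has been met.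
    obtain ⟨s₀, hs₀⟩ := hfin'.bddAbove
    obtain ⟨R₀, hR₀⟩ := pow_unbounded_of_one_lt
      (2 ^ j * D (stageString step (e X) (s₀ + 1))) (show (1 : ℝ) < 2 by norm_num)
    have hkey : ∀ d l, (stageString step (e X) (s₀ + 1)).length ≤ l →
        l ≤ (stageString step (e X) (s₀ + 1 + d)).length →
        Safe g D j R₀ (initSeg (limitSeq step (e X)) l) := by
      intro d
      induction d with
      | zero =>
        intro l hl1 hl2
        obtain rfl : l = (stageString step (e X) (s₀ + 1)).length := le_antisymm hl2 hl1
        rw [hlim]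
        exact fun r hr _ => hR₀.trans_le (pow_le_pow_right₀ (by norm_num) hr)
      | succ d ih =>
        intro l hl1 hl2
        rcases le_total l (stageString step (e X) (s₀ + 1 + d)).length with hl | hl
        · exact ih l hl1 hl
        · have hS := ih _ (stageString_prefix hpre' (e X) (Nat.le_add_right _ d)).length_le le_rfl
          rw [hlim] at hS
          have h3 : initSeg (limitSeq step (e X)) l <+:
              stageString step (e X) (s₀ + 1 + d + 1) := by
            rw [← hlim (s₀ + 1 + d + 1), ← take_initSeg _ hl2]
            exact List.take_prefix _ _
          have h4 : stageString step (e X) (s₀ + 1 + d) <+: initSeg (limitSeq step (e X)) l := by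
            rw [← hlim (s₀ + 1 + d), ← take_initSeg _ hl]
            exact List.take_prefix _ _
          refine hsafe' _ _ _ j R₀ (fun he => ?_) hS _ h4 h3
          by_contra hcon
          have := hs₀ ⟨not_lt.1 hcon, he⟩
          omega
    obtain ⟨r, hr, hcap⟩ := hj (max R₀ (stageString step (e X) (s₀ + 1)).length)
    have hgr : r ≤ g j r := (hgm j).id_le r
    have := hkey (g j r) (g j r) (((le_max_right _ _).trans hr).trans hgr)
      ((Nat.le_add_left _ _).trans (hlenS _)) r ((le_max_left _ _).trans hr)
      (by rw [length_initSeg])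
    exact absurd hcap (not_le.2 this)

/-! ### Boldface `Σ⁰₃` classes -/

theorem isOpen_iff_exists_cylinderOf {O : Set CantorSpace} (hO : IsOpen O) {X : CantorSpace} :
    X ∈ O ↔ ∃ n, cylinderOf (initSeg X n) ⊆ O := by
  constructor
  · intro hX
    obtain ⟨I, u, hu, hIu⟩ := isOpen_pi_iff.1 hO X hX
    refine ⟨I.sup id + 1, fun Y hY => hIu fun i hi => ?_⟩
    rw [mem_cylinderOf_initSeg.1 hY i (Nat.lt_succ_of_le (Finset.le_sup (f := id) hi))]
    exact (hu i hi).2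
  · rintro ⟨n, h⟩
    exact h (mem_cylinderOf_initSeg.2 fun _ _ => rfl)

/-- Membership in a `G_δ` set is the occurrence of infinitely many of countably many clopen events:
for decreasing open sets `P s`, the event `⟨s, n⟩` is that `n` is the first length at which
membership in `P s` is settled. -/
theorem exists_events_of_isOpen {O : ℕ → Set CantorSpace} (hO : ∀ s, IsOpen (O s)) :
    ∃ E : ℕ → Set CantorSpace, (∀ p, IsClopen (E p)) ∧
      ∀ X, X ∈ ⋂ s, O s ↔ {p | X ∈ E p}.Infinite := by
  let P : ℕ → Set CantorSpace := fun s => ⋂ t ∈ Finset.range (s + 1), O t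
  have hP : ∀ s, IsOpen (P s) := fun s => isOpen_biInter_finset fun t _ => hO t
  have hPO : ∀ s X, X ∈ P s ↔ ∀ t ≤ s, X ∈ O t := by
    intro s X
    simp [P]
  let E : ℕ → Set CantorSpace := fun p => {X |
    cylinderOf (initSeg X p.unpair.2) ⊆ P p.unpair.1 ∧
      ∀ m < p.unpair.2, ¬ cylinderOf ((initSeg X p.unpair.2).take m) ⊆ P p.unpair.1}
  have hEl : ∀ X p, X ∈ E p ↔
      IsLeast {n | cylinderOf (initSeg X n) ⊆ P p.unpair.1} p.unpair.2 := by
    intro X p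
    refine and_congr_right fun _ => ?_
    constructor
    · intro h m hm
      by_contra hcon
      exact h m (not_le.1 hcon) (by rwa [take_initSeg X (not_le.1 hcon).le])
    · intro h m hm hsub
      rw [take_initSeg X hm.le] at hsub
      exact absurd (h hsub) (not_le.2 hm)
  refine ⟨E, fun p => isClopen_level (fun w => cylinderOf w ⊆ P p.unpair.1 ∧
    ∀ m < p.unpair.2, ¬ cylinderOf (w.take m) ⊆ P p.unpair.1) p.unpair.2, fun X => ?_⟩
  have hinj : Set.InjOn (fun p : ℕ => p.unpair.1) {p | X ∈ E p} := by
    intro p hp q hq hpq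
    have hp' := (hEl X p).1 hp
    have hq' := (hEl X q).1 hq
    simp only at hpq
    rw [hpq] at hp'
    rw [← Nat.pair_unpair p, ← Nat.pair_unpair q, hpq, hp'.unique hq']
  have himg : (fun p : ℕ => p.unpair.1) '' {p | X ∈ E p} = {s | X ∈ P s} := by
    ext s
    constructor
    · rintro ⟨p, hp, rfl⟩
      exact (isOpen_iff_exists_cylinderOf (hP _)).2 ⟨_, ((hEl X p).1 hp).1⟩
    · intro hs
      obtain ⟨n, hn⟩ := (isOpen_iff_exists_cylinderOf (hP s)).1 hs
      classical
      let S : ∃ n, cylinderOf (initSeg X n) ⊆ P s := ⟨n, hn⟩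
      refine ⟨Nat.pair s (Nat.find S), (hEl X _).2 ?_, by simp⟩
      simp only [Nat.unpair_pair]
      exact ⟨Nat.find_spec S, fun m hm => Nat.find_min' S hm⟩
  rw [← Set.infinite_image_iff hinj, himg, Set.mem_iInter]
  constructor
  · intro h
    have : {s | X ∈ P s} = Set.univ := Set.eq_univ_of_forall fun s => (hPO s X).2 fun t _ => h t
    rw [this]
    exact Set.infinite_univ
  · intro h t
    obtain ⟨s, hs, hts⟩ := h.exists_gt t
    exact (hPO s X).1 hs t hts.le

theorem exists_wadgeReduction {𝒜 : Set CantorSpace} (h𝒜 : IsBoldfaceSigma03 𝒜) :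
    ∃ f : CantorSpace → CantorSpace, IsWadgeReduction f 𝒜 RandSchnorrᶜ := by
  obtain ⟨O, hO, rfl⟩ := h𝒜
  choose E hE hEO using fun k => exists_events_of_isOpen (hO k)
  obtain ⟨f, hf, hfX⟩ := exists_reduction_of_events hE
  refine ⟨f, hf, ?_⟩
  ext X
  rw [Set.mem_iUnion, Set.mem_preimage, Set.mem_compl_iff, ← hfX]
  exact exists_congr fun k => hEO k X

/-- The string with code `n`; the empty string if `n` is not a code. -/
def codedString (n : ℕ) : List Bool := (Encodable.decode n).getD []

/-- The `Σ⁰₃` class of all sequences that belong to the `Σ⁰₃` class which they code: bit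
`⟨k, s, n⟩` of the code says whether the `n`-th basic open set is part of the `(k, s)`-th open
set. -/
def diagonalClass : Set CantorSpace :=
  {X | ∃ k, ∀ s, ∃ n, X (Nat.pair k (Nat.pair s n)) = true ∧
    X ∈ cylinderOf (codedString n)}

theorem isBoldfaceSigma03_diagonalClass : IsBoldfaceSigma03 diagonalClass := by
  refine ⟨fun k s => ⋃ n, {X | X (Nat.pair k (Nat.pair s n)) = true} ∩
    cylinderOf (codedString n), fun k s => isOpen_iUnion fun n => ?_, ?_⟩
  · refine IsOpen.inter ?_ (isClopen_cylinderOf _).isOpen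
    exact (isOpen_discrete ({true} : Set Bool)).preimage
      (continuous_apply (A := fun _ : ℕ => Bool) (Nat.pair k (Nat.pair s n)))
  · ext X
    simp [diagonalClass]

theorem not_isBoldfaceSigma03_compl_diagonalClass : ¬ IsBoldfaceSigma03 diagonalClassᶜ := by
  classical
  rintro ⟨O, hO, h⟩
  let X : CantorSpace := fun p => decide (cylinderOf (codedString p.unpair.2.unpair.2) ⊆
    O p.unpair.1 p.unpair.2.unpair.1)
  have hX : X ∈ diagonalClass ↔ X ∈ diagonalClassᶜ := by
    rw [h]
    simp only [diagonalClass, Set.mem_ofPred_eq, Set.mem_iUnion, Set.mem_iInter]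
    refine exists_congr fun k => forall_congr' fun s => ?_
    simp only [X, Nat.unpair_pair, decide_eq_true_eq]
    constructor
    · rintro ⟨n, hn, hXn⟩
      exact hn hXn
    · intro hXO
      obtain ⟨n, hn⟩ := (isOpen_iff_exists_cylinderOf (hO k s)).1 hXO
      refine ⟨Encodable.encode (initSeg X n), ?_⟩
      rw [codedString, Encodable.encodek, Option.getD_some]
      exact ⟨hn, mem_cylinderOf_initSeg.2 fun _ _ => rfl⟩
  exact iff_not_self hX

theorem IsBoldfaceSigma03.preimage {𝒜 : Set CantorSpace} (h : IsBoldfaceSigma03 𝒜)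
    {f : CantorSpace → CantorSpace} (hf : Continuous f) : IsBoldfaceSigma03 (f ⁻¹' 𝒜) := by
  obtain ⟨O, hO, rfl⟩ := h
  refine ⟨fun k s => f ⁻¹' O k s, fun k s => (hO k s).preimage hf, ?_⟩
  simp only [Set.preimage_iUnion, Set.preimage_iInter]

theorem not_isBoldfaceSigma03_randSchnorr : ¬ IsBoldfaceSigma03 RandSchnorr := by
  intro h
  obtain ⟨f, hf, hfD⟩ := exists_wadgeReduction isBoldfaceSigma03_diagonalClass
  refine not_isBoldfaceSigma03_compl_diagonalClass ?_
  rw [hfD, ← Set.preimage_compl, compl_compl]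
  exact h.preimage hf

theorem mainTheorem8 :
    IsLightfacePi03 RandSchnorr ∧
    ¬ IsBoldfaceSigma03 RandSchnorr ∧
    (∀ 𝒜 : Set CantorSpace, IsBoldfaceSigma03 𝒜 →
      ∃ f : CantorSpace → CantorSpace, IsWadgeReduction f 𝒜 RandSchnorrᶜ) :=
  ⟨isLightfacePi03_randSchnorr, not_isBoldfaceSigma03_randSchnorr,
    fun _ h => exists_wadgeReduction h⟩
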